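/- Let $a_1,\dots,a_n$ be positive integers. A *diameter four tree* of type $(a_1,\dots,a_n)$ over $\overline{\mathbb Q}$ is an isomorphism class $\mathcal T=[\beta]$ of coverings $\beta:\mathbb P^1_{\overline{\mathbb Q}}\to\mathbb P^1_{\overline{\mathbb Q}}$ which are unramified outside $\{0,1,\infty\}$, totally ramified above $\infty$, whose fiber $\beta^{-1}(0)$ consists of exactly $n$ points, with ramification indices $a_1,\dots,a_n$, and which have exactly one ramified point in the fiber $\beta^{-1}(1)$ (so that necessarily $n\ge 2$); here $\beta_1\cong\beta_2$ means $\beta_2=\beta_1\circ\varphi$ for some $\varphi\in\mathrm{PGL}_2(\overline{\mathbb Q})$. The *field of moduli* $\mathbb Q(\mathcal T)$ is the subfield of $\overline{\mathbb Q}$ fixed by all $\sigma\in\mathrm{Gal}(\overline{\mathbb Q}/\mathbb Q)$ such that ${}^\sigma\beta\cong\beta$; it is a number field. A prime number $p$ is called *regular at infinity* if it divides $a_1+\dots+a_n$ but does not divide $$d_\infty(a_1,\dots,a_n)=\prod_{\emptyset\ne S\subsetneq\{1,\dots,n\}}\ \sum_{j\in S}a_j .$$ **Corollary 9.6.** Let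 $\mathcal T$ be a diameter four tree of type $(a_1,\dots,a_n)$ over $\overline{\mathbb Q}$ and suppose that the prime number $p>n$ is regular at infinity. Write $a_1+\dots+a_n=p^hm$ with $p\nmid m$. Then $\mathbb Q(\mathcal T)$ is a number field, and for every maximal ideal $\mathfrak p$ of its ring of integers lying over $p\mathbb Z$, the ramification index $e_{\mathfrak p}$ of $\mathfrak p$ over $p$ satisfies $$e_{\mathfrak p}\ \le\ \frac{n-1}{\gcd(n-1,h)} .$$ -/

import Mathlib

open scoped NumberField

noncomputable section

namespace DiamFour

/-! ### Coverings of the projective line by itself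

Over an algebraically closed field `K`, a covering `β : ℙ¹ → ℙ¹` is a nonconstant rational
function `β ∈ K(X)`, and the (closed) points of `ℙ¹` are the elements of `OnePoint K = K ∪ {∞}`. -/

section Covering

variable {K : Type*} [Field K]

/-- The order of vanishing of a rational function `f` at a point of `ℙ¹(K)`: the normalized
valuation of `K(X)` attached to the point (with the convention that it is `0` for `f = 0`). -/
def ord : OnePoint K → RatFunc K → ℤ
  | OnePoint.infty, f => -f.intDegree
  | OnePoint.some x, f => (f.num.rootMultiplicity x : ℤ) - (f.denom.rootMultiplicity x : ℤ)

/-- The pull-back along `β` of the standard uniformizer at the point `y` of the target line: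
`T - y` for `y ≠ ∞`, and `1 / T` for `y = ∞`. -/
def pullUnif (β : RatFunc K) : OnePoint K → RatFunc K
  | OnePoint.infty => β⁻¹
  | OnePoint.some y => β - RatFunc.C y

/-- The fibre `β⁻¹(y)`, as a set of points of `ℙ¹(K)`. -/
def fibre (β : RatFunc K) (y : OnePoint K) : Set (OnePoint K) :=
  {x | 0 < ord x (pullUnif β y)}

/-- The ramification index of `β` at a point `x` of the fibre `β⁻¹(y)`. -/
def ramIdx (β : RatFunc K) (y x : OnePoint K) : ℤ :=
  ord x (pullUnif β y)

/-- `β` is a covering `ℙ¹ → ℙ¹` with the ramification data of a diameter four tree of type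
`(a₁, …, aₙ)` (the order of the `aᵢ` plays no role). -/
structure IsDiameterFour {n : ℕ} (a : Fin n → ℕ) (β : RatFunc K) : Prop where
  /-- `β` is a covering -/
  nonconstant : ¬ ∃ c : K, β = RatFunc.C c
  /-- `β` is unramified outside `{0, 1, ∞}` -/
  etale : ∀ y : OnePoint K, y ≠ ((0 : K) : OnePoint K) → y ≠ ((1 : K) : OnePoint K) →
    y ≠ OnePoint.infty → ∀ x ∈ fibre β y, ramIdx β y x = 1
  /-- `β` is tamely ramified: the ramification indices are nonzero in `K` -/
  tame : ∀ y : OnePoint K, ∀ x ∈ fibre β y, ((ramIdx β y x : ℤ) : K) ≠ 0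
  /-- `β` is totally ramified above `∞` -/
  total : ∃ x : OnePoint K, fibre β OnePoint.infty = {x}
  /-- the fibre above `0` consists of `n` points, with ramification indices `a₁, …, aₙ` -/
  zero : ∃ x : Fin n → OnePoint K, Function.Injective x ∧
    Set.range x = fibre β ((0 : K) : OnePoint K) ∧
    ∀ i, ramIdx β ((0 : K) : OnePoint K) (x i) = a i
  /-- there is exactly one ramified point above `1` -/
  one : ∃! x : OnePoint K, x ∈ fibre β ((1 : K) : OnePoint K) ∧
    ramIdx β ((1 : K) : OnePoint K) x ≠ 1

end Covering

/-! ### Isomorphism of coverings -/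

section Isomorphism

variable {K : Type*} [Field K]

/-- The Möbius transformation `(aX + b) / (cX + d)`. -/
def moebius (a b c d : K) : RatFunc K :=
  (RatFunc.C a * RatFunc.X + RatFunc.C b) / (RatFunc.C c * RatFunc.X + RatFunc.C d)

/-- The composite `β ∘ φ`, i.e. `β(φ(X))`. -/
def comp (β φ : RatFunc K) : RatFunc K := β.eval RatFunc.C φ

/-- `β₁` and `β₂` are isomorphic: `β₂ = β₁ ∘ φ` for some `φ ∈ PGL₂(K)`. -/
def Iso (β₁ β₂ : RatFunc K) : Prop :=
  ∃ a b c d : K, a * d - b * c ≠ 0 ∧ β₂ = comp β₁ (moebius a b c d)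

theorem linear_ne_zero {c d : K} (h : c ≠ 0 ∨ d ≠ 0) :
    RatFunc.C c * RatFunc.X + RatFunc.C d ≠ (0 : RatFunc K) := by
  have e : RatFunc.C c * RatFunc.X + RatFunc.C d =
      algebraMap (Polynomial K) (RatFunc K) (Polynomial.C c * Polynomial.X + Polynomial.C d) := by
    simp
  rw [e, Ne, map_eq_zero_iff _ (RatFunc.algebraMap_injective K)]
  intro h0
  have h1 := congrArg (fun p => Polynomial.coeff p 0) h0
  have h2 := congrArg (fun p => Polynomial.coeff p 1) h0
  simp at h1 h2
  rcases h with h | h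
  · exact h h2
  · exact h h1

theorem den_ne_zero {a b c d : K} (h : a * d - b * c ≠ 0) :
    RatFunc.C c * RatFunc.X + RatFunc.C d ≠ (0 : RatFunc K) := by
  apply linear_ne_zero
  by_contra! hc
  apply h
  simp [hc.1, hc.2]

theorem moebius_transcendental {a b c d : K} (h : a * d - b * c ≠ 0) :
    Transcendental K (moebius a b c d) := by
  apply RatFunc.transcendental_of_ne_C
  rintro ⟨e, he⟩
  rw [moebius, div_eq_iff (den_ne_zero h)] at he
  have h0 : RatFunc.C (a - e * c) * RatFunc.X + RatFunc.C (b - e * d) = (0 : RatFunc K) := by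
    simp only [map_sub, map_mul]
    linear_combination he
  refine linear_ne_zero ?_ h0
  by_contra! hc
  apply h
  linear_combination d * hc.1 - c * hc.2

/-- Substitution of a Möbius transformation, as a homomorphism of `K(X)`. -/
theorem exists_comp_hom {a b c d : K} (h : a * d - b * c ≠ 0) :
    ∃ f : RatFunc K →ₐ[K] RatFunc K, ∀ β, f β = comp β (moebius a b c d) := by
  refine ⟨(IntermediateField.val _).comp
    (RatFunc.algEquivOfTranscendental _ (moebius_transcendental h)).toAlgHom, fun β => ?_⟩
  have := RatFunc.algEquivOfTranscendental_apply _ (moebius_transcendental h) β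
  simpa [comp, RatFunc.eval, Polynomial.aeval_def] using this

theorem comp_X (β : RatFunc K) : comp β RatFunc.X = β := by
  have e : ∀ p : Polynomial K, p.eval₂ RatFunc.C RatFunc.X = algebraMap _ (RatFunc K) p := by
    intro p
    rw [← RatFunc.aeval_X_left_eq_algebraMap]
    rfl
  rw [comp, RatFunc.eval, e, e, RatFunc.num_div_denom]

theorem comp_comp {a b c d a' b' c' d' : K} (h : a * d - b * c ≠ 0) (h' : a' * d' - b' * c' ≠ 0)
    (β : RatFunc K) : comp (comp β (moebius a b c d)) (moebius a' b' c' d') =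
      comp β (moebius (a * a' + b * c') (a * b' + b * d') (c * a' + d * c') (c * b' + d * d')) := by
  have h'' : (a * a' + b * c') * (c * b' + d * d') - (a * b' + b * d') * (c * a' + d * c') ≠ 0 := by
    have : (a * a' + b * c') * (c * b' + d * d') - (a * b' + b * d') * (c * a' + d * c') =
        (a * d - b * c) * (a' * d' - b' * c') := by ring
    rw [this]
    exact mul_ne_zero h h'
  obtain ⟨f, hf⟩ := exists_comp_hom h
  obtain ⟨f', hf'⟩ := exists_comp_hom h'
  obtain ⟨f'', hf''⟩ := exists_comp_hom h''
  rw [← hf, ← hf', ← hf'']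
  have hX : ∀ φ : RatFunc K, comp RatFunc.X φ = φ := fun φ => by simp [comp]
  have hC : ∀ (g : RatFunc K →ₐ[K] RatFunc K) (e : K), g (RatFunc.C e) = RatFunc.C e :=
    fun g e => g.commutes e
  have key : (f'.comp f) RatFunc.X = f'' RatFunc.X := by
    have h1 := den_ne_zero h
    have h2 := den_ne_zero h'
    have h3 := den_ne_zero h''
    have h4 : f' (RatFunc.C c * RatFunc.X + RatFunc.C d) ≠ 0 := (map_ne_zero f').2 h1
    have hfX : f' RatFunc.X = moebius a' b' c' d' := by rw [hf', hX]
    rw [AlgHom.comp_apply, hf, hX, hf'', hX, moebius, map_div₀, moebius]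
    simp only [map_add, map_mul, hC, hfX, moebius] at h3 h4 ⊢
    rw [div_eq_div_iff h4 h3]
    have hq := div_mul_cancel₀ (RatFunc.C a' * RatFunc.X + RatFunc.C b') h2
    linear_combination (RatFunc.C a * RatFunc.C d - RatFunc.C b * RatFunc.C c) * hq
  rw [← AlgHom.comp_apply]
  have hp : ∀ p : Polynomial K, (f'.comp f) (algebraMap _ _ p) = f'' (algebraMap _ _ p) := by
    intro p
    rw [← RatFunc.aeval_X_left_eq_algebraMap, ← Polynomial.aeval_algHom_apply,
      ← Polynomial.aeval_algHom_apply, key]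
  rw [← RatFunc.num_div_denom β, map_div₀, map_div₀, hp, hp]

variable (K) in
/-- Isomorphism of coverings is an equivalence relation. -/
def isoSetoid : Setoid (RatFunc K) where
  r := Iso
  iseqv := by
    have hX : moebius (1 : K) 0 0 1 = RatFunc.X := by simp [moebius]
    refine ⟨fun β => ⟨1, 0, 0, 1, by simp, by rw [hX, comp_X]⟩, ?_, ?_⟩
    · rintro β₁ β₂ ⟨a, b, c, d, h, rfl⟩
      obtain ⟨D, hD⟩ : ∃ D, D = (a * d - b * c)⁻¹ := ⟨_, rfl⟩
      have hD1 : (a * d - b * c) * D = 1 := by rw [hD, mul_inv_cancel₀ h]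
      have h' : (d * D) * (a * D) - (-b * D) * (-c * D) ≠ 0 := by
        have : (d * D) * (a * D) - (-b * D) * (-c * D) = D := by
          linear_combination D * hD1
        rw [this, hD]
        exact inv_ne_zero h
      refine ⟨_, _, _, _, h', ?_⟩
      rw [comp_comp h h']
      have e : ∀ w x y z : K, w = 1 → x = 0 → y = 0 → z = 1 → β₁ = comp β₁ (moebius w x y z) := by
        rintro _ _ _ _ rfl rfl rfl rfl
        rw [hX, comp_X]
      apply e
      · linear_combination hD1
      · ring
      · ring
      · linear_combination hD1
    · rintro β₁ β₂ β₃ ⟨a, b, c, d, h, rfl⟩ ⟨a', b', c', d', h', rfl⟩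
      refine ⟨_, _, _, _, ?_, comp_comp h h' β₁⟩
      have : (a * a' + b * c') * (c * b' + d * d') - (a * b' + b * d') * (c * a' + d * c') =
        (a * d - b * c) * (a' * d' - b' * c') := by ring
      rw [this]
      exact mul_ne_zero h h'

variable (K) in
/-- Isomorphism classes `[β]` of rational functions under `PGL₂(K)`. -/
def CoverClass : Type _ := Quotient (isoSetoid K)

/-- The valency class `IV_{a₁, …, aₙ}(K)`: the set of diameter four trees of type `(a₁, …, aₙ)`
over `K`, i.e. of isomorphism classes of coverings with the required ramification data. -/
def valencyClass {n : ℕ} (a : Fin n → ℕ) (K : Type*) [Field K] : Set (CoverClass K) :=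
  {T | ∃ β : RatFunc K, IsDiameterFour a β ∧ T = Quotient.mk (isoSetoid K) β}

end Isomorphism

/-! ### Galois action and field of moduli -/

section Galois

variable {F K : Type*} [Field F] [Field K] [Algebra F K]

/-- The conjugate `^σβ`: the automorphism `σ` acts on the coefficients of `β`. -/
def conj (σ : Gal(K/F)) : RatFunc K ≃+* RatFunc K :=
  IsFractionRing.ringEquivOfRingEquiv (Polynomial.mapEquiv σ.toRingEquiv)

theorem conj_algebraMap (σ : Gal(K/F)) (p : Polynomial K) :
    conj σ (algebraMap _ _ p) = algebraMap _ _ (p.map (σ : K →+* K)) := by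
  exact IsFractionRing.ringEquivOfRingEquiv_algebraMap _ p

theorem conj_comp (σ : Gal(K/F)) (a b c d : K) (h : a * d - b * c ≠ 0) (β : RatFunc K) :
    conj σ (comp β (moebius a b c d)) = comp (conj σ β) (moebius (σ a) (σ b) (σ c) (σ d)) := by
  have h' : σ a * σ d - σ b * σ c ≠ 0 := by
    simpa only [← map_mul, ← map_sub] using (map_ne_zero σ).2 h
  obtain ⟨f, hf⟩ := exists_comp_hom h
  obtain ⟨f', hf'⟩ := exists_comp_hom h'
  have hC : ∀ e : K, conj σ (RatFunc.C e) = RatFunc.C (σ e) := fun e => by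
    rw [← RatFunc.algebraMap_C, conj_algebraMap, Polynomial.map_C, RatFunc.algebraMap_C]
    rfl
  have hX : conj σ RatFunc.X = RatFunc.X := by
    rw [← RatFunc.algebraMap_X, conj_algebraMap, Polynomial.map_X]
  have hm : conj σ (moebius a b c d) = moebius (σ a) (σ b) (σ c) (σ d) := by
    simp only [moebius, map_div₀, map_add, map_mul, hC, hX]
  have hcX : ∀ φ : RatFunc K, comp RatFunc.X φ = φ := fun φ => by simp [comp]
  have hp : ∀ p : Polynomial K, conj σ (f (algebraMap _ _ p)) =
      f' (conj σ (algebraMap _ _ p)) := by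
    intro p
    induction p using Polynomial.induction_on' with
    | add p q hp hq => simp only [map_add, hp, hq]
    | monomial k e =>
      rw [← Polynomial.C_mul_X_pow_eq_monomial]
      simp only [map_mul, map_pow, RatFunc.algebraMap_C, RatFunc.algebraMap_X, hC, hX]
      have h1 : f (RatFunc.C e) = RatFunc.C e := f.commutes e
      have h2 : f' (RatFunc.C (σ e)) = RatFunc.C (σ e) := f'.commutes (σ e)
      rw [h1, h2, hC, hf, hf', hcX, hcX, hm]
  rw [← hf, ← hf', ← RatFunc.num_div_denom β]
  simp only [map_div₀, hp]

theorem conj_one (β : RatFunc K) : conj (1 : Gal(K/F)) β = β := by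
  rw [← RatFunc.num_div_denom β, map_div₀, conj_algebraMap, conj_algebraMap]
  have e : ((1 : Gal(K/F)) : K →+* K) = RingHom.id K := rfl
  rw [e, Polynomial.map_id, Polynomial.map_id]

theorem conj_mul (σ τ : Gal(K/F)) (β : RatFunc K) : conj (σ * τ) β = conj σ (conj τ β) := by
  rw [← RatFunc.num_div_denom β]
  simp only [map_div₀, conj_algebraMap, Polynomial.map_map]
  rfl

/-- The action of the Galois group on isomorphism classes, `σ • [β] = [^σβ]`. -/
instance galAction : MulAction Gal(K/F) (CoverClass K) where
  smul σ := Quotient.map (conj σ) (by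
    rintro β₁ β₂ ⟨a, b, c, d, h, rfl⟩
    refine ⟨σ a, σ b, σ c, σ d, ?_, conj_comp σ a b c d h β₁⟩
    simpa only [← map_mul, ← map_sub] using (map_ne_zero σ).2 h)
  one_smul := by
    rintro ⟨β⟩
    exact congrArg (Quotient.mk (isoSetoid K)) (conj_one β)
  mul_smul σ τ := by
    rintro ⟨β⟩
    exact congrArg (Quotient.mk (isoSetoid K)) (conj_mul σ τ β)

variable (F) in
/-- The field of moduli `F(T)`: the subfield of `K` fixed by all `σ ∈ Gal(K/F)` with `^σβ ≅ β`,
where `T = [β]`. -/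
def fieldOfModuli (T : CoverClass K) : IntermediateField F K :=
  IntermediateField.fixedField (MulAction.stabilizer Gal(K/F) T)

end Galois

/-! ### Regularity at infinity -/

/-- `d_∞(a₁, …, aₙ)`: the product of the sums `∑_{j ∈ S} aⱼ` over all nonempty proper subsets `S`
of `{1, …, n}`. -/
def dInfty {n : ℕ} (a : Fin n → ℕ) : ℕ :=
  ∏ S : Finset (Fin n) with S.Nonempty ∧ S ≠ Finset.univ, ∑ j ∈ S, a j

/-- The prime `p` is regular at infinity for `(a₁, …, aₙ)`. -/
def RegularAtInfinity {n : ℕ} (a : Fin n → ℕ) (p : ℕ) : Prop :=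
  p ∣ ∑ i, a i ∧ ¬ p ∣ dInfty a

end DiamFour

end

/-! Put `e = n - 1` and `N = ∑ aᵢ`. Moving the pole to `∞` and the ramified point above `1` to `0`
turns the tree into a polynomial `∏ (1 - zᵢ X) ^ aᵢ`. Counting zeros of its derivative gives order
`e` at `0`, which by the logarithmic derivative means `∑ aᵢ zᵢ ^ k = 0` for `1 ≤ k ≤ e`
(`IsDiameterFour.exists_weightedProd`). The `zᵢ` matter only up to a common factor.

Choose `π` with `π ^ e = N`, scale so that `z₀ = -1`, and write `zᵢ = π vᵢ - 1`. Then `v₀ = 0` and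
`∑ aᵢ vᵢ ^ k = π ^ (e - k)` for `k ≤ e` (`exists_adapted_moments`). At a place above `p`, regularity
at infinity forces the `vᵢ` to be integral with distinct residues, and since `e < p` the Jacobian of
the system, a Vandermonde matrix up to units, is invertible there. A solution is therefore
determined by its residues (`eq_of_moments_eq`), and an inertia element fixing `π` fixes every `vᵢ`,
hence the class `T`, hence its field of moduli (`map_eq_of_moments`).

With `g = gcd(e, h)`, `E = e / g` and `l = h / g`, one may take `π = τ ^ l * μ` where `τ ^ E = p`
and `μ ^ e = m`. Inertia fixes `μ` up to the condition of fixing nothing else, because `m` and `e`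
are prime to `p`; only `τ` can move, and it has at most `E` conjugates. Orbit-stabilizer bounds the
ramification index by `E` (`ramificationIdx_le`). -/

noncomputable section

namespace DiamFour

/-! ### Inertia groups and ramification indices. -/

section Ramification

variable {K M : Type*} [Field K] [Field M] [NumberField K] [NumberField M] [Algebra K M]
  [IsGalois ℚ M]

/-- Inertia orders are the ramification indices of the Galois extensions `M/K` and `M/ℚ`, and
indices multiply in the tower; `K/ℚ` itself need not be Galois. -/
theorem ramificationIdx_mul_card_inertia (𝔭 : Ideal (𝓞 K)) (P : Ideal (𝓞 M)) [𝔭.IsMaximal]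
    [P.IsMaximal] [P.LiesOver 𝔭] :
    𝔭.ramificationIdx ℤ * Nat.card (P.inertia Gal(M/K)) = Nat.card (P.inertia Gal(M/ℚ)) := by
  have : IsGalois K M := IsGalois.tower_top_of_isGalois ℚ K M
  let q : Ideal ℤ := 𝔭.under ℤ
  have : P.LiesOver q := Ideal.LiesOver.trans P 𝔭 q
  rw [Ideal.card_inertia_eq_ramificationIdxIn (G := Gal(M/K)) 𝔭 P,
    Ideal.card_inertia_eq_ramificationIdxIn (G := Gal(M/ℚ)) q P,
    Ideal.ramificationIdxIn_eq_ramificationIdx 𝔭 P Gal(M/K),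
    Ideal.ramificationIdxIn_eq_ramificationIdx q P Gal(M/ℚ),
    Ideal.ramificationIdx_tower (R := ℤ) 𝔭 P]

/-- If the elements of inertia which fix an `E`-th root `τ` of a rational number fix `K`, then the
ramification index is at most `E`. -/
theorem ramificationIdx_le (𝔭 : Ideal (𝓞 K)) (P : Ideal (𝓞 M)) [𝔭.IsMaximal]
    [P.IsMaximal] [P.LiesOver 𝔭] {E : ℕ} (hE : 0 < E) (τ : M) (c : ℚ)
    (hτ : τ ^ E = algebraMap ℚ M c)
    (H : ∀ σ ∈ P.inertia Gal(M/ℚ), σ τ = τ → ∀ x : K, σ (algebraMap K M x) = algebraMap K M x) :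
    𝔭.ramificationIdx ℤ ≤ E := by
  have hmul := ramificationIdx_mul_card_inertia (K := K) 𝔭 P
  let I := P.inertia Gal(M/ℚ)
  have h1 : Nat.card (MulAction.orbit I τ) * Nat.card (MulAction.stabilizer I τ) = Nat.card I := by
    rw [← Nat.card_prod, Nat.card_congr (MulAction.orbitProdStabilizerEquivGroup I τ)]
  have h2 : Nat.card (MulAction.orbit I τ) ≤ E := by
    have hsub : MulAction.orbit I τ ⊆ {x | x ∈ Polynomial.nthRoots E (algebraMap ℚ M c)} := by
      rintro _ ⟨σ, rfl⟩
      rw [Set.mem_ofPred_eq, Polynomial.mem_nthRoots hE]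
      change (σ.1 τ) ^ E = _
      rw [← map_pow, hτ, σ.1.commutes]
    classical
    have hfin : {x | x ∈ Polynomial.nthRoots E (algebraMap ℚ M c)} =
        ((Polynomial.nthRoots E (algebraMap ℚ M c)).toFinset : Set M) := by
      ext; simp
    rw [hfin] at hsub
    calc Nat.card (MulAction.orbit I τ)
        ≤ ((Polynomial.nthRoots E (algebraMap ℚ M c)).toFinset : Set M).ncard :=
          Set.ncard_le_ncard hsub (Finset.finite_toSet _)
      _ ≤ Multiset.card (Polynomial.nthRoots E (algebraMap ℚ M c)) := by
          rw [Set.ncard_coe_finset]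
          exact Multiset.toFinset_card_le _
      _ ≤ E := Polynomial.card_nthRoots _ _
  -- By `H`, inertia elements fixing `τ` are `K`-linear, so they lie in the inertia group of `M/K`.
  have h3 : Nat.card (MulAction.stabilizer I τ) ≤ Nat.card (P.inertia Gal(M/K)) := by
    refine Nat.card_le_card_of_injective (fun σ =>
      ⟨AlgEquiv.ofRingEquiv (f := (σ.1.1 : M ≃ₐ[ℚ] M).toRingEquiv) (H σ.1.1 σ.1.2 σ.2),
        fun x => ?_⟩) ?_
    · exact σ.1.2 x
    · intro σ σ' hs
      ext x
      exact DFunLike.congr_fun (congrArg Subtype.val hs) x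
  have h4 : 0 < Nat.card (P.inertia Gal(M/K)) := Nat.card_pos
  refine Nat.le_of_mul_le_mul_right ?_ h4
  rw [hmul, ← h1]
  exact Nat.mul_le_mul h2 h3

end Ramification

/-- Elements of inertia act trivially on the residue field. -/
theorem valuation_sub_lt_one {M : Type*} [Field M] [NumberField M]
    (v : IsDedekindDomain.HeightOneSpectrum (𝓞 M)) {σ : Gal(M/ℚ)}
    (hσ : σ ∈ v.asIdeal.inertia Gal(M/ℚ)) {x : M} (hx : v.valuation M x ≤ 1) :
    v.valuation M (σ x - x) < 1 := by
  obtain ⟨y, d, hyd⟩ := v.exists_primeCompl_mul_eq_of_integer x hx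
  have hval : ∀ r : 𝓞 M, r ∉ v.asIdeal → v.valuation M (algebraMap (𝓞 M) M r) = 1 := by
    intro r hr
    rw [v.valuation_of_algebraMap, v.intValuation_eq_one_iff_mem_primeCompl]
    exact hr
  have hd : v.valuation M (algebraMap (𝓞 M) M d) = 1 := hval _ d.2
  have hsd : σ • (d : 𝓞 M) ∉ v.asIdeal := fun hmem => d.2 (by
    have := v.asIdeal.sub_mem hmem (hσ d)
    simpa using this)
  have hsd' : v.valuation M (σ (algebraMap (𝓞 M) M d)) = 1 := hval _ hsd
  -- Write `x = y / d` with `d` outside the prime; multiplying by the unit `σ(d) d` reduces the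
  -- claim to the integers `y` and `d`, where it is the definition of inertia.
  have key : (σ x - x) * (σ (algebraMap (𝓞 M) M d) * algebraMap (𝓞 M) M d) =
      algebraMap (𝓞 M) M ((σ • y - y) * d - y * (σ • (d : 𝓞 M) - d)) := by
    have e1 : ∀ r : 𝓞 M, algebraMap (𝓞 M) M (σ • r) = σ (algebraMap (𝓞 M) M r) := fun _ => rfl
    simp only [map_sub, map_mul, e1, ← hyd]
    ring
  have hlt : v.valuation M (algebraMap (𝓞 M) M ((σ • y - y) * d - y * (σ • (d : 𝓞 M) - d))) < 1 := by
    rw [v.valuation_lt_one_iff_mem]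
    exact v.asIdeal.sub_mem (Ideal.mul_mem_right _ _ (hσ y)) (Ideal.mul_mem_left _ _ (hσ _))
  rw [← key, map_mul, map_mul, hsd', hd] at hlt
  simpa using hlt

/-! ### Vanishing weighted power sums over a field. -/

section Moments

open Finset

/-- Vandermonde in the form of Lagrange interpolation: pair the weights with a polynomial of degree
less than `D` that vanishes at every value of `u` except `y`. -/
theorem sum_filter_eq_zero_of_moments {F ι : Type*} [Field F] [DecidableEq F] (t : Finset ι)
    (c u : ι → F) {D : ℕ} (hD : #(t.image u) ≤ D) (hmom : ∀ k < D, ∑ i ∈ t, c i * u i ^ k = 0)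
    (y : F) : ∑ i ∈ t with u i = y, c i = 0 := by
  by_cases hy : y ∈ t.image u
  swap
  · rw [filter_eq_empty_iff.2 (by rintro i hi rfl; exact hy (mem_image_of_mem u hi)), sum_empty]
  let f : Polynomial F := ∏ x ∈ (t.image u).erase y, (Polynomial.X - Polynomial.C x)
  have hdeg : f.natDegree < D := by
    rw [Polynomial.natDegree_finsetProd_X_sub_C_eq_card]
    exact (card_erase_lt_of_mem hy).trans_le hD
  have h0 : ∑ i ∈ t, c i * f.eval (u i) = 0 := by
    simp_rw [Polynomial.eval_eq_sum_range' hdeg, mul_sum]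
    rw [sum_comm]
    refine sum_eq_zero fun k hk => ?_
    rw [← mul_zero (f.coeff k), ← hmom k (mem_range.1 hk), mul_sum]
    exact sum_congr rfl fun i _ => by ring
  have hf : f.eval y ≠ 0 := by
    rw [Polynomial.eval_prod, prod_ne_zero_iff]
    intro x hx
    simpa [sub_eq_zero] using (ne_of_mem_erase hx).symm
  have h1 : ∑ i ∈ t, c i * f.eval (u i) = (∑ i ∈ t with u i = y, c i) * f.eval y := by
    rw [sum_mul, sum_filter]
    refine sum_congr rfl fun i hi => ?_
    split_ifs with h
    · rw [h]
    · rw [Polynomial.eval_prod, prod_eq_zero (mem_erase.2 ⟨h, mem_image_of_mem u hi⟩) (by simp),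
        mul_zero]
  rw [h1] at h0
  exact (mul_eq_zero.1 h0).resolve_right hf

end Moments

/-! ### Integrality, separation and Hensel uniqueness for the moment system. -/

section Valuation

open Finset

variable {M Γ₀ ι : Type*} [Field M] [LinearOrderedCommGroupWithZero Γ₀] (w : Valuation M Γ₀)

theorem residue_eq_zero_iff_valuation_lt_one (x : w.valuationSubring) :
    IsLocalRing.residue w.valuationSubring x = 0 ↔ w (x : M) < 1 := by
  rw [IsLocalRing.residue_eq_zero_iff, IsLocalRing.mem_maximalIdeal, mem_nonunits_iff,
    (Valuation.valuationSubring.integers w).isUnit_iff_valuation_eq_one]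
  exact (lt_iff_le_and_ne.trans (and_iff_right x.2)).symm

-- The preceding vanishing lemma read in the residue field of `w`. The set `s` represents all
-- residue classes, so its size bounds the number of moments needed.
open Classical in
theorem valuation_sum_filter_lt_one (t s : Finset ι) (c u : ι → M) (hu : ∀ i, w (u i) ≤ 1)
    (hc : ∀ i, w (c i) ≤ 1) (hs : ∀ i ∈ t, ∃ j ∈ s, w (u i - u j) < 1)
    (hmom : ∀ k < #s, w (∑ i ∈ t, c i * u i ^ k) < 1) (i₀ : ι) :
    w (∑ i ∈ t with w (u i - u i₀) < 1, c i) < 1 := by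
  let O := w.valuationSubring
  let r := IsLocalRing.residue O
  let u' : ι → O := fun i => ⟨u i, hu i⟩
  let c' : ι → O := fun i => ⟨c i, hc i⟩
  have hr : ∀ i j, r (u' i) = r (u' j) ↔ w (u i - u j) < 1 := fun i j => by
    rw [← sub_eq_zero, ← map_sub]
    exact residue_eq_zero_iff_valuation_lt_one w _
  have key := sum_filter_eq_zero_of_moments t (fun i => r (c' i)) (fun i => r (u' i)) (D := #s) ?_ ?_
    (r (u' i₀))
  · simp_rw [hr] at key
    rw [← map_sum] at key
    have := (residue_eq_zero_iff_valuation_lt_one w _).1 key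
    rwa [AddSubmonoidClass.coe_finsetSum] at this
  · refine le_trans (card_le_card ?_) (card_image_le (s := s) (f := fun i => r (u' i)))
    intro y hy
    obtain ⟨i, hi, rfl⟩ := mem_image.1 hy
    obtain ⟨j, hj, hij⟩ := hs i hi
    exact mem_image.2 ⟨j, hj, ((hr i j).2 hij).symm⟩
  · intro k hk
    simp_rw [← map_pow, ← map_mul, ← map_sum]
    rw [residue_eq_zero_iff_valuation_lt_one]
    have := hmom k hk
    rw [AddSubmonoidClass.coe_finsetSum]
    exact this

variable {w}

theorem exists_pow_add_eq {x δ : M} (hnat : ∀ q : ℕ, w q ≤ 1) (hx : w x ≤ 1) (hδ : w δ ≤ 1)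
    (j : ℕ) : ∃ c, w c ≤ 1 ∧ (x + δ) ^ (j + 1) = x ^ (j + 1) + (j + 1 : ℕ) * x ^ j * δ + c * δ ^ 2 := by
  induction j with
  | zero => exact ⟨0, by simp, by simp⟩
  | succ j ih =>
    obtain ⟨c, hc, h⟩ := ih
    refine ⟨c * (x + δ) + (j + 1 : ℕ) * x ^ j, ?_, ?_⟩
    · refine w.map_add_le ?_ ?_
      · rw [map_mul]
        exact mul_le_one' hc (w.map_add_le hx hδ)
      · rw [map_mul, map_pow]
        exact mul_le_one' (hnat _) (pow_le_one' hx _)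
    · rw [pow_succ (x + δ), h]
      push_cast
      ring

/-- With `y = x + δ`, the difference `y ^ e - x ^ e` is `δ` times `e x ^ (e - 1) + c δ`, and the
latter is a unit. -/
theorem eq_of_pow_eq {x y : M} (hnat : ∀ q : ℕ, w q ≤ 1) (hx : w x = 1) (hxy : w (y - x) < 1)
    {e : ℕ} (he : w e = 1) (h : y ^ e = x ^ e) : y = x := by
  obtain _ | j := e
  · simp at he
  obtain ⟨δ, rfl⟩ : ∃ δ, y = x + δ := ⟨y - x, by ring⟩
  rw [add_sub_cancel_left] at hxy
  obtain ⟨c, hc, h'⟩ := exists_pow_add_eq hnat hx.le hxy.le j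
  rw [h] at h'
  have h0 : δ * ((j + 1 : ℕ) * x ^ j + c * δ) = 0 := by linear_combination -h'
  rcases mul_eq_zero.1 h0 with h0 | h0
  · simp [h0]
  · have h1 : w ((j + 1 : ℕ) * x ^ j) = w (c * δ) := by
      rw [eq_neg_of_add_eq_zero_left h0, w.map_neg]
    rw [map_mul, map_mul, map_pow, he, hx, one_pow, one_mul] at h1
    exact absurd h1 (mul_lt_one_of_nonneg_of_lt_one_right hc zero_le hxy).ne'

variable [Fintype ι]

/-- Divide by the largest `v i₁`. If it is not integral, all `e + 1` rescaled moments reduce to `0`,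
so every residue class has total weight divisible by `p`. The class of `i₀` contains the value `0`
but not `i₁`, whose rescaled value is `1`, contradicting `hreg`. -/
theorem valuation_le_one_of_moments {p : ℕ} (hp : ∀ q : ℕ, w q < 1 ↔ p ∣ q)
    (hnat : ∀ q : ℕ, w q ≤ 1) (a : ι → ℕ)
    (hreg : ∀ S : Finset ι, S.Nonempty → S ≠ univ → ¬ p ∣ ∑ i ∈ S, a i)
    {π : M} (hπ : w π < 1) (hπ0 : π ≠ 0) (v : ι → M) {i₀ : ι} (h0 : v i₀ = 0) {e : ℕ} (he : 0 < e)
    (hcard : Fintype.card ι = e + 1)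
    (hmom : ∀ k ≤ e, ∑ i, (a i : M) * v i ^ k = π ^ e / π ^ k) (i : ι) : w (v i) ≤ 1 := by
  classical
  obtain ⟨i₁, -, hmax⟩ := exists_max_image univ (fun i => w (v i)) ⟨i₀, mem_univ _⟩
  refine (hmax i (mem_univ i)).trans ?_
  by_contra! hgt
  have hne : v i₁ ≠ 0 := fun h => by simp [h] at hgt
  have hlt := valuation_sum_filter_lt_one w univ univ (fun i => (a i : M)) (fun i => v i / v i₁) ?_
    (fun i => hnat _) (fun i _ => ⟨i, mem_univ i, by simp⟩) ?_ i₀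
  · rw [← Nat.cast_sum, hp] at hlt
    refine hreg _ ⟨i₀, by simp⟩ (fun h => ?_) hlt
    have := (mem_filter.1 (h ▸ mem_univ i₁)).2
    simp [h0, hne] at this
  · intro i
    rw [map_div₀]
    exact div_le_one_of_le₀ (hmax i (mem_univ i)) zero_le
  · intro k hk
    rw [card_univ, hcard] at hk
    have e1 : ∑ i, (a i : M) * (v i / v i₁) ^ k = π ^ (e - k) * (v i₁)⁻¹ ^ k := by
      have e2 : π ^ (e - k) = π ^ e / π ^ k := by
        rw [eq_div_iff (pow_ne_zero _ hπ0), ← pow_add, Nat.sub_add_cancel (by omega)]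
      rw [e2, ← hmom k (by omega), sum_mul]
      exact sum_congr rfl fun i _ => by rw [div_eq_mul_inv, mul_pow, mul_assoc]
    rw [e1, map_mul, map_pow, map_pow, map_inv₀]
    obtain rfl | hk0 := Nat.eq_zero_or_pos k
    · simpa using pow_lt_one₀ zero_le hπ he.ne'
    · refine mul_lt_one_of_nonneg_of_lt_one_right (pow_le_one' hπ.le _) zero_le
        (pow_lt_one₀ zero_le ?_ hk0.ne')
      exact inv_lt_one_of_one_lt₀ hgt

/-- If two residues agree, there are at most `e` classes, and the moments of degree below `e`, all
small, suffice. By `hreg` the class of `i₀` is then everything, so every `v i` reduces to `0`; but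
the moment of degree `e` is `1`. -/
theorem valuation_sub_eq_one_of_moments {p : ℕ} (hp : ∀ q : ℕ, w q < 1 ↔ p ∣ q)
    (hnat : ∀ q : ℕ, w q ≤ 1) (a : ι → ℕ)
    (hreg : ∀ S : Finset ι, S.Nonempty → S ≠ univ → ¬ p ∣ ∑ i ∈ S, a i)
    {π : M} (hπ : w π < 1) (hπ0 : π ≠ 0) (v : ι → M) {i₀ : ι} (h0 : v i₀ = 0) {e : ℕ} (he : 0 < e)
    (hcard : Fintype.card ι = e + 1)
    (hmom : ∀ k ≤ e, ∑ i, (a i : M) * v i ^ k = π ^ e / π ^ k) {i j : ι} (hij : i ≠ j) :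
    w (v i - v j) = 1 := by
  classical
  have hle := valuation_le_one_of_moments hp hnat a hreg hπ hπ0 v h0 he hcard hmom
  refine le_antisymm ((w.map_sub _ _).trans (max_le (hle i) (hle j))) ?_
  by_contra! hlt
  have hcl := valuation_sum_filter_lt_one w univ (univ.erase i) (fun i => (a i : M)) v hle
    (fun i => hnat _) (fun l _ => ?_) (fun k hk => ?_) i₀
  · rw [← Nat.cast_sum, hp] at hcl
    have huniv : ∀ l, w (v l) < 1 := by
      intro l
      by_contra hl
      refine hreg _ ⟨i₀, by simp⟩ (fun h => hl ?_) hcl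
      have hmem := mem_univ l
      rw [← h, mem_filter, h0, sub_zero] at hmem
      exact hmem.2
    have h1 := congrArg w (hmom e le_rfl)
    rw [div_self (pow_ne_zero _ hπ0), map_one] at h1
    refine h1.not_lt (w.map_sum_lt one_ne_zero fun l _ => ?_)
    rw [map_mul, map_pow]
    exact mul_lt_one_of_nonneg_of_lt_one_right (hnat _) zero_le (pow_lt_one₀ zero_le (huniv l) he.ne')
  · by_cases hl : l = i
    · exact ⟨j, mem_erase.2 ⟨hij.symm, mem_univ _⟩, hl ▸ hlt⟩
    · exact ⟨l, mem_erase.2 ⟨hl, mem_univ _⟩, by simp⟩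
  · rw [card_erase_of_mem (mem_univ _), card_univ, hcard, Nat.add_sub_cancel] at hk
    rw [hmom k hk.le, map_div₀, map_pow, map_pow]
    have hw0 : 0 < w π := zero_lt_iff.2 ((w.ne_zero_iff).2 hπ0)
    rw [div_lt_one₀ (pow_pos hw0 _)]
    exact pow_lt_pow_right_of_lt_one₀ hw0 hπ hk

/-- Uniqueness in Hensel's lemma for the system of the power sums with weights `a i`. -/
theorem eq_of_moments_eq (hnat : ∀ q : ℕ, w q ≤ 1) (a : ι → ℕ) (ha : ∀ i, w (a i) = 1)
    {e : ℕ} (hcard : Fintype.card ι = e + 1) (he : ∀ k, 0 < k → k ≤ e → w (k : M) = 1)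
    {v v' : ι → M} (hle : ∀ i, w (v i) ≤ 1) (hdist : ∀ i j, i ≠ j → w (v i - v j) = 1)
    {i₀ : ι} (h0 : v' i₀ = v i₀) (hclose : ∀ i, w (v' i - v i) < 1)
    (hmom : ∀ k ≤ e, ∑ i, (a i : M) * v' i ^ k = ∑ i, (a i : M) * v i ^ k) : v' = v := by
  classical
  obtain ⟨δ, hδ⟩ : ∃ δ : ι → M, ∀ i, v' i = v i + δ i := ⟨fun i => v' i - v i, fun i => by ring⟩
  simp only [hδ, add_sub_cancel_left] at hclose h0 hmom
  -- Normalizing by the largest increment `δ i₁` keeps the linear terms visible while the quadratic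
  -- ones become small.
  obtain ⟨i₁, -, hmax⟩ := exists_max_image univ (fun i => w (δ i)) ⟨i₀, mem_univ _⟩
  by_cases hne : δ i₁ = 0
  · ext i
    have := hmax i (mem_univ i)
    rw [hne, map_zero, le_zero_iff, map_eq_zero] at this
    rw [hδ, this, add_zero]
  exfalso
  have h0' : δ i₀ = 0 := by simpa using h0
  have hi : i₁ ≠ i₀ := fun h => hne (h ▸ h0')
  have hε : ∀ i, w (δ i / δ i₁) ≤ 1 := fun i => by
    rw [map_div₀]
    exact div_le_one_of_le₀ (hmax i (mem_univ i)) zero_le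
  -- The index `i₀` has no increment, leaving `e` unknowns with distinct residues against `e`
  -- linearized equations; the class of `i₁` is a singleton of unit weight.
  have hlt := valuation_sum_filter_lt_one w (univ.erase i₀) (univ.erase i₀)
    (fun i => a i * (δ i / δ i₁)) v hle (fun i => ?_) (fun i hi => ⟨i, hi, by simp⟩) (fun j hj => ?_) i₁
  · have hs : (univ.erase i₀).filter (fun i => w (v i - v i₁) < 1) = {i₁} := by
      ext i
      simp only [mem_filter, mem_erase, mem_univ, and_true, mem_singleton]
      refine ⟨fun h => ?_, fun h => by simp [h, hi]⟩
      by_contra hne'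
      exact h.2.ne (hdist i i₁ hne')
    rw [hs, sum_singleton, map_mul, ha, div_self hne, map_one, one_mul] at hlt
    exact lt_irrefl _ hlt
  · rw [map_mul]
    exact mul_le_one' (hnat _) (hε i)
  · rw [card_erase_of_mem (mem_univ _), card_univ, hcard, Nat.add_sub_cancel] at hj
    choose c hc hexp using fun i => exists_pow_add_eq hnat (hle i) (hclose i).le j
    have h1 := hmom (j + 1) hj
    simp_rw [hexp] at h1
    -- The equation of degree `j + 1`, divided by `δ i₁`: linear part on the left, second-order
    -- remainder on the right. The factor `j + 1 ≤ e` is a unit.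
    have h2 : (j + 1 : ℕ) * ∑ i ∈ univ.erase i₀, (a i * (δ i / δ i₁)) * v i ^ j =
        - ∑ i, a i * (c i * (δ i / δ i₁) * δ i) := by
      have h4 : ∑ i ∈ univ.erase i₀, (a i * (δ i / δ i₁)) * v i ^ j =
          ∑ i, (a i * (δ i / δ i₁)) * v i ^ j := by
        rw [← add_sum_erase _ _ (mem_univ i₀), h0']
        simp
      rw [h4, ← add_eq_zero_iff_eq_neg, ← mul_left_inj' hne, zero_mul, ← sub_eq_zero.2 h1, mul_sum,
        ← sum_add_distrib, sum_mul, ← sum_sub_distrib]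
      refine sum_congr rfl fun i _ => ?_
      field_simp
      ring
    have h3 : w ((j + 1 : ℕ) * ∑ i ∈ univ.erase i₀, (a i * (δ i / δ i₁)) * v i ^ j) < 1 := by
      rw [h2, w.map_neg]
      refine w.map_sum_lt one_ne_zero fun i _ => ?_
      rw [map_mul, map_mul, map_mul]
      exact mul_lt_one_of_nonneg_of_lt_one_right (hnat _) zero_le
        (mul_lt_one_of_nonneg_of_lt_one_right (mul_le_one' (hc i) (hε i)) zero_le (hclose i))
    rwa [map_mul, he _ j.succ_pos hj, one_mul] at h3

end Valuation

/-! ### Orders of vanishing under Möbius substitutions. -/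

section Order

variable {K : Type*} [Field K]

open Polynomial

theorem ord_zero (x : OnePoint K) : ord x (0 : RatFunc K) = 0 := by
  induction x <;> simp [ord]

theorem ord_algebraMap_infty (p : K[X]) :
    ord OnePoint.infty (algebraMap K[X] (RatFunc K) p) = -p.natDegree := by
  simp [ord]

theorem ord_algebraMap_coe (p : K[X]) (x : K) :
    ord (x : OnePoint K) (algebraMap K[X] (RatFunc K) p) = p.rootMultiplicity x := by
  change ((algebraMap K[X] (RatFunc K) p).num.rootMultiplicity x : ℤ) -
    ((algebraMap K[X] (RatFunc K) p).denom.rootMultiplicity x : ℤ) = _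
  rw [RatFunc.num_algebraMap, RatFunc.denom_algebraMap, ← C_1, rootMultiplicity_C]
  simp

theorem ord_mul (x : OnePoint K) {f g : RatFunc K} (hf : f ≠ 0) (hg : g ≠ 0) :
    ord x (f * g) = ord x f + ord x g := by
  induction x with
  | infty =>
    change -(f * g).intDegree = -f.intDegree + -g.intDegree
    rw [RatFunc.intDegree_mul hf hg]
    ring
  | coe x =>
    change ((f * g).num.rootMultiplicity x : ℤ) - ((f * g).denom.rootMultiplicity x : ℤ) =
      (f.num.rootMultiplicity x : ℤ) - (f.denom.rootMultiplicity x : ℤ) +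
        ((g.num.rootMultiplicity x : ℤ) - (g.denom.rootMultiplicity x : ℤ))
    have h := congrArg (rootMultiplicity x) (RatFunc.num_denom_mul f g)
    have hf' := RatFunc.num_ne_zero hf
    have hg' := RatFunc.num_ne_zero hg
    have hfg' := RatFunc.num_ne_zero (mul_ne_zero hf hg)
    have d1 := f.denom_ne_zero
    have d2 := g.denom_ne_zero
    have d3 := (f * g).denom_ne_zero
    rw [rootMultiplicity_mul (mul_ne_zero hfg' (mul_ne_zero d1 d2)),
      rootMultiplicity_mul (mul_ne_zero d1 d2), rootMultiplicity_mul
      (mul_ne_zero (mul_ne_zero hf' hg') d3), rootMultiplicity_mul (mul_ne_zero hf' hg')] at h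
    omega

theorem ord_inv (x : OnePoint K) (f : RatFunc K) : ord x f⁻¹ = -ord x f := by
  by_cases hf : f = 0
  · simp [hf, ord_zero]
  have h1 : ord x (1 : RatFunc K) = 0 := by
    have := ord_mul x (one_ne_zero (α := RatFunc K)) one_ne_zero
    rw [one_mul] at this
    omega
  have := ord_mul x hf (inv_ne_zero hf)
  rw [mul_inv_cancel₀ hf, h1] at this
  omega

theorem ord_C (x : OnePoint K) (c : K) : ord x (RatFunc.C c) = 0 := by
  rw [← RatFunc.algebraMap_C]
  induction x with
  | infty => rw [ord_algebraMap_infty, natDegree_C]; rfl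
  | coe x => rw [ord_algebraMap_coe, rootMultiplicity_C]; rfl

theorem ord_X_sub_C_infty (r : K) : ord OnePoint.infty (RatFunc.X - RatFunc.C r) = -1 := by
  rw [← RatFunc.algebraMap_C, ← RatFunc.algebraMap_X, ← map_sub, ord_algebraMap_infty]
  simp

open Classical in
theorem ord_X_sub_C_coe (x r : K) :
    ord (x : OnePoint K) (RatFunc.X - RatFunc.C r) = if x = r then 1 else 0 := by
  rw [← RatFunc.algebraMap_C, ← RatFunc.algebraMap_X, ← map_sub, ord_algebraMap_coe,
    rootMultiplicity_X_sub_C]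
  split_ifs <;> simp

theorem X_sub_C_ne_zero (r : K) : RatFunc.X - RatFunc.C r ≠ (0 : RatFunc K) := by
  rw [← RatFunc.algebraMap_C, ← RatFunc.algebraMap_X, ← map_sub, Ne,
    map_eq_zero_iff _ (RatFunc.algebraMap_injective K)]
  exact Polynomial.X_sub_C_ne_zero r

/-- Both sides are additive in `g`, and over an algebraically closed field constants and the `X - r`
generate the nonzero rational functions. -/
theorem ord_map_eq [IsAlgClosed K] (f : RatFunc K →ₐ[K] RatFunc K) (P : OnePoint K → OnePoint K)
    (h : ∀ x r, ord x (f (RatFunc.X - RatFunc.C r)) = ord (P x) (RatFunc.X - RatFunc.C r))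
    (x : OnePoint K) (g : RatFunc K) : ord x (f g) = ord (P x) g := by
  have hpol : ∀ p : K[X], ord x (f (algebraMap _ _ p)) = ord (P x) (algebraMap _ _ p) := by
    intro p
    by_cases hp : p = 0
    · simp [hp, ord_zero]
    have hC : f (RatFunc.C p.leadingCoeff) = RatFunc.C p.leadingCoeff := f.commutes _
    have hprod : ∀ s : Multiset K, (s.map fun r => RatFunc.X - RatFunc.C r).prod ≠ 0 ∧
        ord x (f (s.map fun r => RatFunc.X - RatFunc.C r).prod) =
        ord (P x) (s.map fun r => RatFunc.X - RatFunc.C r).prod := by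
      intro s
      induction s using Multiset.induction_on with
      | empty =>
        have h1 := fun y : OnePoint K => ord_C y (1 : K)
        simp only [map_one] at h1
        simp [h1]
      | cons r s ih =>
        rw [Multiset.map_cons, Multiset.prod_cons, map_mul, ord_mul _ (X_sub_C_ne_zero r) ih.1,
          ord_mul _ ((map_ne_zero f).2 (X_sub_C_ne_zero r)) ((map_ne_zero f).2 ih.1), h, ih.2]
        exact ⟨mul_ne_zero (X_sub_C_ne_zero r) ih.1, rfl⟩
    have hlc : RatFunc.C p.leadingCoeff ≠ (0 : RatFunc K) := by simpa using hp
    have e : algebraMap K[X] (RatFunc K) p = RatFunc.C p.leadingCoeff *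
        (p.roots.map fun r => RatFunc.X - RatFunc.C r).prod := by
      conv_lhs => rw [(IsAlgClosed.splits p).eq_prod_roots]
      rw [map_mul, RatFunc.algebraMap_C, map_multiset_prod, Multiset.map_map]
      congr 3
      ext r : 1
      simp
    rw [e, map_mul, hC, ord_mul _ hlc (hprod _).1, ord_mul _ hlc ((map_ne_zero f).2 (hprod _).1),
      (hprod _).2, ord_C, ord_C]
  by_cases hg : g = 0
  · simp [hg, ord_zero]
  have hn : algebraMap K[X] (RatFunc K) g.num ≠ 0 := by simpa using hg
  have hd : (algebraMap K[X] (RatFunc K) g.denom)⁻¹ ≠ 0 := by simpa using g.denom_ne_zero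
  rw [← RatFunc.num_div_denom g, div_eq_mul_inv, map_mul, map_inv₀, ord_mul _ hn hd,
    ord_mul _ ((map_ne_zero f).2 hn) (by simpa using hd), ord_inv, ord_inv, hpol, hpol]

theorem pullUnif_map (f : RatFunc K →ₐ[K] RatFunc K) (β : RatFunc K) (y : OnePoint K) :
    pullUnif (f β) y = f (pullUnif β y) := by
  have hC : ∀ y : K, f (RatFunc.C y) = RatFunc.C y := f.commutes
  induction y <;> simp [pullUnif, hC]

variable {n : ℕ} {a : Fin n → ℕ}

theorem fibre_map {f : RatFunc K →ₐ[K] RatFunc K} {P : OnePoint K ≃ OnePoint K}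
    (h : ∀ x g, ord x (f g) = ord (P x) g) (β : RatFunc K) (y : OnePoint K) :
    fibre (f β) y = P ⁻¹' fibre β y := by
  ext x
  simp [fibre, pullUnif_map, h]

/-- Apart from nonconstancy, the ramification data are expressed through `ord` alone, so they
transport along the bijection `P` of points. -/
theorem IsDiameterFour.map {β : RatFunc K} (hβ : IsDiameterFour a β)
    (f : RatFunc K →ₐ[K] RatFunc K) (P : OnePoint K ≃ OnePoint K)
    (h : ∀ x g, ord x (f g) = ord (P x) g) : IsDiameterFour a (f β) := by
  have hf := fibre_map h β
  have hr : ∀ y x, ramIdx (f β) y x = ramIdx β y (P x) := fun y x => by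
    simp [ramIdx, pullUnif_map, h]
  constructor
  · rintro ⟨c, hc⟩
    refine hβ.nonconstant ⟨c, f.toRingHom.injective (hc.trans (f.commutes c).symm)⟩
  · intro y h0 h1 h2 x hx
    rw [hf] at hx
    rw [hr]
    exact hβ.etale y h0 h1 h2 _ hx
  · intro y x hx
    rw [hf] at hx
    rw [hr]
    exact hβ.tame y _ hx
  · obtain ⟨x, hx⟩ := hβ.total
    refine ⟨P.symm x, ?_⟩
    rw [hf, hx]
    ext y
    simp [Equiv.eq_symm_apply]
  · obtain ⟨x, hinj, hrange, ha⟩ := hβ.zero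
    refine ⟨fun i => P.symm (x i), P.symm.injective.comp hinj, ?_, fun i => ?_⟩
    · rw [hf, ← hrange]
      ext y
      simp only [Set.mem_range, Set.mem_preimage, Equiv.symm_apply_eq]
    · rw [hr, P.apply_symm_apply, ha]
  · obtain ⟨x, hx, hu⟩ := hβ.one
    refine ⟨P.symm x, ?_, fun y hy => ?_⟩
    · beta_reduce
      rw [hf, hr, Set.mem_preimage, P.apply_symm_apply]
      exact hx
    · beta_reduce at hy
      rw [hf, hr] at hy
      rw [Equiv.eq_symm_apply]
      exact hu _ hy

open Classical in
theorem exists_translation [IsAlgClosed K] (c : K) : ∃ f : RatFunc K →ₐ[K] RatFunc K,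
    (∀ β, Iso β (f β)) ∧ ∃ P : OnePoint K ≃ OnePoint K, (∀ x g, ord x (f g) = ord (P x) g) ∧
      P OnePoint.infty = OnePoint.infty ∧ P ((0 : K) : OnePoint K) = (c : OnePoint K) := by
  have hdet : (1 : K) * 1 - c * 0 ≠ 0 := by simp
  obtain ⟨f, hf⟩ := exists_comp_hom hdet
  let P : OnePoint K ≃ OnePoint K := Equiv.optionCongr (Equiv.addRight c)
  have hP : ∀ x : K, P (x : OnePoint K) = ((x + c : K) : OnePoint K) := fun _ => rfl
  have hP' : P OnePoint.infty = OnePoint.infty := rfl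
  refine ⟨f, fun β => ⟨1, c, 0, 1, hdet, hf β⟩, P, ord_map_eq f P fun x r => ?_, hP', by simp [hP]⟩
  have e : f (RatFunc.X - RatFunc.C r) = RatFunc.X - RatFunc.C (r - c) := by
    have hC : f (RatFunc.C r) = RatFunc.C r := f.commutes r
    rw [map_sub, hC, hf]
    simp [comp, moebius]
    ring
  rw [e]
  induction x with
  | infty => rw [hP', ord_X_sub_C_infty, ord_X_sub_C_infty]
  | coe x =>
    rw [hP, ord_X_sub_C_coe, ord_X_sub_C_coe]
    exact if_congr eq_sub_iff_add_eq rfl rfl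

theorem exists_inversion [IsAlgClosed K] : ∃ f : RatFunc K →ₐ[K] RatFunc K,
    (∀ β, Iso β (f β)) ∧ ∃ P : OnePoint K ≃ OnePoint K, (∀ x g, ord x (f g) = ord (P x) g) ∧
      P OnePoint.infty = ((0 : K) : OnePoint K) := by
  classical
  have hdet : (0 : K) * 0 - 1 * 1 ≠ 0 := by simp
  obtain ⟨f, hf⟩ := exists_comp_hom hdet
  let P₀ : OnePoint K → OnePoint K := fun x => OnePoint.rec ((0 : K) : OnePoint K)
    (fun x => if x = 0 then OnePoint.infty else ((x⁻¹ : K) : OnePoint K)) x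
  have hi : P₀ OnePoint.infty = ((0 : K) : OnePoint K) := rfl
  have h0 : P₀ ((0 : K) : OnePoint K) = OnePoint.infty := if_pos rfl
  have hx0 : ∀ x : K, x ≠ 0 → P₀ (x : OnePoint K) = ((x⁻¹ : K) : OnePoint K) := fun x hx => if_neg hx
  have hinv : Function.Involutive P₀ := by
    intro x
    induction x with
    | infty => rw [hi, h0]
    | coe x =>
      by_cases hx : x = 0
      · rw [hx, h0, hi]
      · rw [hx0 x hx, hx0 _ (inv_ne_zero hx), inv_inv]
  refine ⟨f, fun β => ⟨0, 1, 1, 0, hdet, hf β⟩, hinv.toPerm, ord_map_eq f P₀ fun x r => ?_, hi⟩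
  have hX0 : (RatFunc.X : RatFunc K) ≠ 0 := RatFunc.X_ne_zero
  have hX : ∀ x : OnePoint K, ord x (RatFunc.X : RatFunc K) = ord x (RatFunc.X - RatFunc.C 0) := by
    simp
  have e : f (RatFunc.X - RatFunc.C r) = RatFunc.X⁻¹ - RatFunc.C r := by
    have hC : f (RatFunc.C r) = RatFunc.C r := f.commutes r
    rw [map_sub, hC, hf]
    simp [comp, moebius]
  rw [e]
  by_cases hr : r = 0
  · rw [hr, map_zero, sub_zero, sub_zero, ord_inv, hX, hX]
    induction x with
    | infty => rw [hi, ord_X_sub_C_infty, ord_X_sub_C_coe]; simp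
    | coe x =>
      by_cases hx : x = 0
      · rw [hx, h0, ord_X_sub_C_infty, ord_X_sub_C_coe]; simp
      · rw [hx0 x hx, ord_X_sub_C_coe, ord_X_sub_C_coe]; simp [hx]
  · have hCr : RatFunc.C (-r) ≠ (0 : RatFunc K) := by simpa using hr
    have e' : RatFunc.X⁻¹ - RatFunc.C r =
        RatFunc.C (-r) * ((RatFunc.X - RatFunc.C r⁻¹) * RatFunc.X⁻¹) := by
      have : RatFunc.C r ≠ (0 : RatFunc K) := by simpa using hr
      rw [map_inv₀, map_neg]
      field_simp
      ring
    rw [e', ord_mul _ hCr (mul_ne_zero (X_sub_C_ne_zero _) (inv_ne_zero hX0)),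
      ord_mul _ (X_sub_C_ne_zero _) (inv_ne_zero hX0), ord_C, ord_inv, hX]
    induction x with
    | infty => rw [hi, ord_X_sub_C_infty, ord_X_sub_C_infty, ord_X_sub_C_coe]; simp [Ne.symm hr]
    | coe x =>
      by_cases hx : x = 0
      · rw [hx, h0, ord_X_sub_C_infty, ord_X_sub_C_coe, ord_X_sub_C_coe]
        simp [Ne.symm hr]
      · rw [hx0 x hx, ord_X_sub_C_coe, ord_X_sub_C_coe, ord_X_sub_C_coe]
        simp [hx, inv_eq_iff_eq_inv]

end Order

/-! ### The polynomial normal form and its moment equations. -/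

section NormalForm

variable {K : Type*} [Field K] {n : ℕ} {a : Fin n → ℕ}

open Polynomial

/-- The polynomial `∏ (1 - zᵢ X) ^ aᵢ`. -/
def weightedProd (a : Fin n → ℕ) (z : Fin n → K) : K[X] := ∏ i, (1 - C (z i) * X) ^ a i

/-- Logarithmic derivative: each factor contributes `-aᵢ zᵢ / (1 - zᵢ X)`, expanded as a geometric
series. -/
theorem derivative_prod_one_sub_pow (a : Fin n → ℕ) (z : Fin n → K) (s : Finset (Fin n)) :
    PowerSeries.derivative K (∏ i ∈ s, (1 - PowerSeries.C (z i) * PowerSeries.X) ^ a i) =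
      -(∏ i ∈ s, (1 - PowerSeries.C (z i) * PowerSeries.X) ^ a i) *
        PowerSeries.mk fun k => ∑ i ∈ s, (a i : K) * z i ^ (k + 1) := by
  classical
  induction s using Finset.induction_on with
  | empty =>
    have : (PowerSeries.mk fun _ => (0 : K)) = 0 := by ext; simp
    simp [this]
  | insert i s hi ih =>
    let q : PowerSeries K := 1 - PowerSeries.C (z i) * PowerSeries.X
    have hq : q * (PowerSeries.mk fun k => z i ^ k) = 1 := by
      ext k
      cases k with
      | zero => simp [q, sub_mul, mul_assoc]
      | succ k => simp [q, sub_mul, mul_assoc, PowerSeries.coeff_one, pow_succ']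
    have hdq : PowerSeries.derivative K q = -PowerSeries.C (z i) := by
      simp [q]
    have hpow : PowerSeries.derivative K (q ^ a i) =
        -q ^ a i * ((a i : PowerSeries K) * PowerSeries.C (z i) * PowerSeries.mk fun k => z i ^ k) := by
      rw [PowerSeries.derivative_pow, hdq]
      obtain h | j := a i
      · simp
      · rw [Nat.add_sub_cancel, pow_succ]
        linear_combination ((j + 1 : ℕ) : PowerSeries K) * q ^ j * PowerSeries.C (z i) * hq
    have hmk : (PowerSeries.mk fun k => ∑ l ∈ insert i s, (a l : K) * z l ^ (k + 1)) =
        (a i : PowerSeries K) * PowerSeries.C (z i) * (PowerSeries.mk fun k => z i ^ k) +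
          PowerSeries.mk fun k => ∑ l ∈ s, (a l : K) * z l ^ (k + 1) := by
      ext k
      have : (a i : PowerSeries K) = PowerSeries.C (a i : K) := by simp
      rw [this, ← map_mul, map_add, PowerSeries.coeff_C_mul, PowerSeries.coeff_mk,
        PowerSeries.coeff_mk, PowerSeries.coeff_mk, Finset.sum_insert hi, pow_succ', mul_assoc]
    rw [Finset.prod_insert hi, Derivation.leibniz, ih, hmk, hpow, smul_eq_mul, smul_eq_mul]
    ring

/-- The product has constant term `1`, so it is a unit among power series and `X ^ e` must divide
the generating series of the moments. -/
theorem moments_eq_zero_of_dvd {z : Fin n → K} {e : ℕ}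
    (h : X ^ e ∣ derivative (weightedProd a z)) (k : ℕ) (hk : k < e) :
    ∑ i, (a i : K) * z i ^ (k + 1) = 0 := by
  let B : PowerSeries K := ∏ i, (1 - PowerSeries.C (z i) * PowerSeries.X) ^ a i
  have hB : ((weightedProd a z : K[X]) : PowerSeries K) = B := by
    have := map_prod (Polynomial.coeToPowerSeries.ringHom (R := K))
      (fun i => (1 - C (z i) * X) ^ a i) Finset.univ
    simpa only [weightedProd, B, coeToPowerSeries.ringHom_apply, Polynomial.coe_pow, coe_sub,
      coe_one, coe_mul, coe_C, coe_X] using this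
  have h1 : (PowerSeries.X : PowerSeries K) ^ e ∣ PowerSeries.derivative K B := by
    rw [← hB, PowerSeries.derivative_coe]
    simpa using map_dvd (Polynomial.coeToPowerSeries.ringHom (R := K)) h
  rw [derivative_prod_one_sub_pow] at h1
  have hu : IsUnit (-B) := by
    rw [IsUnit.neg_iff, PowerSeries.isUnit_iff_constantCoeff]
    simp [B]
  rw [hu.dvd_mul_left, PowerSeries.X_pow_dvd_iff] at h1
  simpa using h1 k hk

variable [IsAlgClosed K] [CharZero K]

/-- The normal form of a diameter four tree which is a polynomial with its ramified point above `1`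
at the origin. -/
theorem eq_weightedProd (ha : ∀ i, 0 < a i) {P : K[X]} (hP : 0 < P.natDegree)
    (hetale : ∀ x, P.eval x ≠ 0 → P.eval x ≠ 1 → ¬ P.derivative.IsRoot x)
    (x : Fin n → K) (hinj : Function.Injective x) (hx : ∀ r, P.IsRoot r ↔ ∃ i, x i = r)
    (hmult : ∀ i, P.rootMultiplicity (x i) = a i) (h0 : P.eval 0 = 1)
    (h0' : P.derivative.IsRoot 0)
    (hone : ∀ r, P.eval r = 1 → P.derivative.IsRoot r → r = 0) :
    2 ≤ n ∧ ∃ z : Fin n → K, (∀ i, z i ≠ 0) ∧ (∀ k, 0 < k → k < n → ∑ i, (a i : K) * z i ^ k = 0) ∧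
      P = weightedProd a z := by
  classical
  have hP0 : P ≠ 0 := by rintro rfl; simp at hP
  have hroots : P.roots.toFinset = Finset.univ.image x := by
    ext r
    rw [Multiset.mem_toFinset, mem_roots hP0, hx]
    simp
  have hx0 : ∀ i, x i ≠ 0 := fun i h => by
    have := (hx 0).2 ⟨i, h⟩
    rw [IsRoot.def, h0] at this
    exact one_ne_zero this
  have hdeg : P.natDegree = ∑ i, a i := by
    rw [← IsAlgClosed.card_roots_eq_natDegree, ← Multiset.toFinset_sum_count_eq, hroots,
      Finset.sum_image hinj.injOn]
    simp [hmult]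
  have hD0 : P.derivative ≠ 0 := by
    intro h
    rw [derivative_eq_zero] at h
    exact hP.ne' h
  have hDroots : P.derivative.roots.toFinset ⊆ insert 0 (Finset.univ.image x) := by
    intro r hr
    rw [Multiset.mem_toFinset, mem_roots hD0] at hr
    by_cases h : P.eval r = 0
    · obtain ⟨i, rfl⟩ := (hx r).1 h
      simp
    · by_cases h' : P.eval r = 1
      · rw [hone r h' hr]; simp
      · exact absurd hr (hetale r h h')
  -- The derivative has degree `N - 1`, order `a i - 1` at each `x i`, and no other zero but `0`;
  -- hence its order at `0` is `n - 1`. As this order is positive, `n ≥ 2`.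
  have hDdeg : P.derivative.natDegree = P.derivative.rootMultiplicity 0 + ∑ i, (a i - 1) := by
    have hDm : ∀ i, P.derivative.rootMultiplicity (x i) = a i - 1 := fun i => by
      rw [derivative_rootMultiplicity_of_root ((hx _).2 ⟨i, rfl⟩), hmult]
    rw [← IsAlgClosed.card_roots_eq_natDegree, ← Multiset.sum_count_eq_card (s := insert 0 (Finset.univ.image x)),
      Finset.sum_insert, Finset.sum_image hinj.injOn]
    · simp [hDm]
    · simpa using hx0
    · intro r hr; exact hDroots (Multiset.mem_toFinset.2 hr)
  have hsum : ∑ i, (a i - 1) + n = ∑ i, a i := by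
    have : ∑ i, ((a i - 1) + 1) = ∑ i, a i := Finset.sum_congr rfl fun i _ => Nat.sub_add_cancel (ha i)
    rw [← this, Finset.sum_add_distrib]
    simp
  rw [natDegree_derivative] at hDdeg
  have hm0 : 0 < P.derivative.rootMultiplicity 0 := (rootMultiplicity_pos hD0).2 h0'
  have hm : P.derivative.rootMultiplicity 0 = n - 1 := by omega
  -- The leading constant is fixed by `P(0) = 1`.
  have hPz : P = weightedProd a fun i => (x i)⁻¹ := by
    have h1 : P = C P.leadingCoeff * ∏ i, (X - C (x i)) ^ a i := by
      conv_lhs => rw [(IsAlgClosed.splits P).eq_prod_roots]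
      rw [Finset.prod_multiset_map_count, hroots, Finset.prod_image hinj.injOn]
      simp [hmult]
    have h2 : ∀ i, (X - C (x i)) ^ a i = C ((-x i) ^ a i) * (1 - C ((x i)⁻¹) * X) ^ a i := fun i => by
      rw [C_pow, ← mul_pow]
      congr 1
      have h3 : C (x i) * C (x i)⁻¹ = 1 := by rw [← C_mul, mul_inv_cancel₀ (hx0 i), C_1]
      rw [C_neg]
      linear_combination -X * h3
    rw [Finset.prod_congr rfl fun i _ => h2 i, Finset.prod_mul_distrib, ← map_prod, ← mul_assoc,
      ← C_mul] at h1
    have h4 := congrArg (eval 0) h1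
    rw [h0] at h4
    simp only [eval_prod, eval_mul, eval_C, eval_pow, eval_sub, eval_one, eval_X, mul_zero, sub_zero,
      one_pow, Finset.prod_const_one, mul_one] at h4
    rw [h1, ← h4, C_1, one_mul, weightedProd]
  refine ⟨by omega, fun i => (x i)⁻¹, fun i => inv_ne_zero (hx0 i), fun k hk hkn => ?_, hPz⟩
  obtain ⟨k, rfl⟩ := Nat.exists_eq_succ_of_ne_zero hk.ne'
  refine moments_eq_zero_of_dvd (e := n - 1) ?_ k (by omega)
  rw [← hPz, ← hm]
  simpa using P.derivative.pow_rootMultiplicity_dvd 0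

end NormalForm

/-! ### Bringing an arbitrary covering to normal form. -/

section Reduction

variable {K : Type*} [Field K] {n : ℕ} {a : Fin n → ℕ}

open Polynomial

theorem Iso.trans {β₁ β₂ β₃ : RatFunc K} (h : Iso β₁ β₂) (h' : Iso β₂ β₃) : Iso β₁ β₃ :=
  (isoSetoid K).iseqv.trans h h'

theorem pullUnif_algebraMap (P : K[X]) (y : K) :
    pullUnif (algebraMap K[X] (RatFunc K) P) (y : OnePoint K) = algebraMap _ _ (P - C y) := by
  rw [map_sub, RatFunc.algebraMap_C]
  rfl

theorem ramIdx_algebraMap (P : K[X]) (x y : K) :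
    ramIdx (algebraMap K[X] (RatFunc K) P) (y : OnePoint K) (x : OnePoint K) =
      (P - C y).rootMultiplicity x := by
  rw [ramIdx, pullUnif_algebraMap, ord_algebraMap_coe]

theorem coe_mem_fibre_iff {P : K[X]} (hP : 0 < P.natDegree) (x y : K) :
    (x : OnePoint K) ∈ fibre (algebraMap K[X] (RatFunc K) P) (y : OnePoint K) ↔ P.eval x = y := by
  have h0 : P - C y ≠ 0 := fun h => by
    have := natDegree_sub_C (p := P) (a := y)
    rw [h, natDegree_zero] at this
    omega
  rw [fibre, Set.mem_ofPred_eq, pullUnif_algebraMap, ord_algebraMap_coe, Nat.cast_pos,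
    rootMultiplicity_pos h0, IsRoot.def, eval_sub, eval_C, sub_eq_zero]

theorem infty_notMem_fibre (P : K[X]) (y : K) :
    OnePoint.infty ∉ fibre (algebraMap K[X] (RatFunc K) P) (y : OnePoint K) := by
  rw [fibre, Set.mem_ofPred_eq, pullUnif_algebraMap, ord_algebraMap_infty]
  omega

variable [IsAlgClosed K]

/-- A root of the denominator would be a finite pole. -/
theorem exists_polynomial {β : RatFunc K} (h : fibre β OnePoint.infty = {OnePoint.infty}) :
    ∃ P : K[X], β = algebraMap _ _ P ∧ 0 < P.natDegree := by
  have hd : β.denom = 1 := by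
    rw [← (RatFunc.monic_denom β).natDegree_eq_zero]
    by_contra hne
    obtain ⟨r, hr⟩ := IsAlgClosed.exists_root β.denom fun h => hne (natDegree_eq_of_degree_eq_some h)
    have hn : ¬ β.num.IsRoot r := by
      obtain ⟨u, v, huv⟩ := RatFunc.isCoprime_num_denom β
      intro hr'
      have := congrArg (eval r) huv
      rw [eval_add, eval_mul, eval_mul, hr, hr', mul_zero, mul_zero, add_zero, eval_one] at this
      exact zero_ne_one this
    have hmem : (r : OnePoint K) ∈ fibre β OnePoint.infty := by
      change 0 < ord (r : OnePoint K) β⁻¹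
      rw [ord_inv]
      change 0 < -((β.num.rootMultiplicity r : ℤ) - (β.denom.rootMultiplicity r : ℤ))
      have h1 := rootMultiplicity_eq_zero hn
      have h2 := (rootMultiplicity_pos β.denom_ne_zero).2 hr
      omega
    rw [h] at hmem
    exact OnePoint.coe_ne_infty r hmem
  have hβ : β = algebraMap _ _ β.num := by
    conv_lhs => rw [← RatFunc.num_div_denom β, hd, map_one, div_one]
  refine ⟨β.num, hβ, ?_⟩
  have hmem : OnePoint.infty ∈ fibre β OnePoint.infty := h ▸ rfl
  change 0 < ord OnePoint.infty β⁻¹ at hmem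
  rw [ord_inv, hβ, ord_algebraMap_infty] at hmem
  omega

theorem IsDiameterFour.exists_fibre_infty {β : RatFunc K} (hβ : IsDiameterFour a β) :
    ∃ β', Iso β β' ∧ IsDiameterFour a β' ∧ fibre β' OnePoint.infty = {OnePoint.infty} := by
  obtain ⟨x₀, hx₀⟩ := hβ.total
  induction x₀ with
  | infty => exact ⟨β, (isoSetoid K).iseqv.refl β, hβ, hx₀⟩
  | coe c =>
    -- Translate the unique pole `c` to `0`, then invert.
    obtain ⟨f, hf, P, hP, -, hPc⟩ := exists_translation c
    obtain ⟨g, hg, Q, hQ, hQ0⟩ := exists_inversion (K := K)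
    refine ⟨g (f β), (hf β).trans (hg _), (hβ.map f P hP).map g Q hQ, ?_⟩
    rw [fibre_map hQ, fibre_map hP, hx₀]
    ext x
    rw [Set.mem_preimage, Set.mem_preimage, Set.mem_singleton_iff, Set.mem_singleton_iff, ← hPc,
      P.apply_eq_iff_eq, ← hQ0, Q.apply_eq_iff_eq]

theorem IsDiameterFour.exists_polynomial {β : RatFunc K} (hβ : IsDiameterFour a β) :
    ∃ P : K[X], Iso β (algebraMap _ _ P) ∧ IsDiameterFour a (algebraMap K[X] (RatFunc K) P) ∧
      0 < P.natDegree ∧ P.eval 0 = 1 ∧ (P - C 1).rootMultiplicity 0 ≠ 1 := by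
  obtain ⟨β₁, hiso, hβ₁, hfib⟩ := hβ.exists_fibre_infty
  obtain ⟨P₁, rfl, hdeg⟩ := DiamFour.exists_polynomial hfib
  obtain ⟨y, ⟨hy, hy'⟩, -⟩ := hβ₁.one
  induction y with
  | infty => exact absurd hy (infty_notMem_fibre P₁ 1)
  | coe c =>
    -- Translating the ramified point above `1` to the origin leaves the pole at `∞`.
    obtain ⟨f, hf, P, hP, hPi, hPc⟩ := exists_translation c
    have hfib' : fibre (f (algebraMap _ _ P₁)) OnePoint.infty = {OnePoint.infty} := by
      rw [fibre_map hP, hfib]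
      ext x
      rw [Set.mem_preimage, Set.mem_singleton_iff, Set.mem_singleton_iff]
      conv_lhs => rw [← hPi]
      exact P.apply_eq_iff_eq
    obtain ⟨P₂, hP₂, hdeg₂⟩ := DiamFour.exists_polynomial hfib'
    have hr : ramIdx (algebraMap K[X] (RatFunc K) P₂) ((1 : K) : OnePoint K) ((0 : K) : OnePoint K) =
        ramIdx (algebraMap K[X] (RatFunc K) P₁) ((1 : K) : OnePoint K) (c : OnePoint K) := by
      rw [← hP₂, ramIdx, pullUnif_map, hP, hPc, ramIdx]
    refine ⟨P₂, hP₂ ▸ hiso.trans (hf _), hP₂ ▸ hβ₁.map f P hP, hdeg₂, ?_, ?_⟩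
    · rw [← coe_mem_fibre_iff hdeg₂, ← hP₂, fibre_map hP, Set.mem_preimage, hPc]
      exact hy
    · rw [← hr, ramIdx_algebraMap] at hy'
      exact_mod_cast hy'

/-- Every diameter four tree is given by a polynomial `∏ (1 - zᵢ X) ^ aᵢ`, where the weighted power
sums of the `zᵢ` vanish in degrees `1, …, n - 1`. -/
theorem IsDiameterFour.exists_weightedProd [CharZero K] (ha : ∀ i, 0 < a i) {β : RatFunc K}
    (hβ : IsDiameterFour a β) :
    2 ≤ n ∧ ∃ z : Fin n → K, (∀ i, z i ≠ 0) ∧ (∀ k, 0 < k → k < n → ∑ i, (a i : K) * z i ^ k = 0) ∧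
      Iso β (algebraMap _ _ (weightedProd a z)) := by
  obtain ⟨P, hiso, hβ', hdeg, h0, hram⟩ := hβ.exists_polynomial
  have hne : ∀ y : K, P - C y ≠ 0 := fun y h => by
    have := natDegree_sub_C (p := P) (a := y)
    rw [h, natDegree_zero] at this
    omega
  have hmult : ∀ x y : K, P.eval x = y →
      ((P - C y).rootMultiplicity x ≠ 1 ↔ P.derivative.IsRoot x) := by
    intro x y hxy
    have hroot : (P - C y).IsRoot x := by simp [hxy]
    have h1 := one_lt_rootMultiplicity_iff_isRoot (t := x) (hne y)
    have h2 := (rootMultiplicity_pos (hne y)).2 hroot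
    rw [derivative_sub, derivative_C, sub_zero, and_iff_right hroot] at h1
    rw [← h1]
    omega
  obtain ⟨x, hinj, hrange, hx⟩ := hβ'.zero
  have hfin : ∀ i, ∃ r : K, (r : OnePoint K) = x i := by
    intro i
    have hi : x i ∈ fibre (algebraMap K[X] (RatFunc K) P) ((0 : K) : OnePoint K) :=
      hrange ▸ Set.mem_range_self i
    rw [← OnePoint.ne_infty_iff_exists]
    rintro h
    exact infty_notMem_fibre P 0 (h ▸ hi)
  choose r hr using hfin
  have hP0 : P - C 0 = P := by simp
  have hetale : ∀ s, P.eval s ≠ 0 → P.eval s ≠ 1 → ¬ P.derivative.IsRoot s := by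
    intro s hs0 hs1 hs
    refine (hmult s _ rfl).2 hs ?_
    have := hβ'.etale (P.eval s : K) (by simpa using hs0) (by simpa using hs1)
      (OnePoint.coe_ne_infty _) s ((coe_mem_fibre_iff hdeg _ _).2 rfl)
    rw [ramIdx_algebraMap] at this
    exact_mod_cast this
  have hrinj : Function.Injective r := by
    intro i j hij
    apply hinj
    rw [← hr i, ← hr j, hij]
  have hroots : ∀ s, P.IsRoot s ↔ ∃ i, r i = s := by
    intro s
    rw [IsRoot.def, ← coe_mem_fibre_iff hdeg, ← hrange]
    simp [← hr]
  have hrmult : ∀ i, P.rootMultiplicity (r i) = a i := by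
    intro i
    have := hx i
    rw [← hr, ramIdx_algebraMap, hP0] at this
    exact_mod_cast this
  have hone : ∀ s, P.eval s = 1 → P.derivative.IsRoot s → s = 0 := by
    intro s hs hs'
    refine OnePoint.coe_injective (hβ'.one.unique ⟨(coe_mem_fibre_iff hdeg _ _).2 hs, ?_⟩
      ⟨(coe_mem_fibre_iff hdeg _ _).2 h0, ?_⟩)
    · rw [ramIdx_algebraMap]
      exact_mod_cast (hmult s 1 hs).2 hs'
    · rw [ramIdx_algebraMap]
      exact_mod_cast hram
  obtain ⟨h2, z, hz, hmom, rfl⟩ := eq_weightedProd ha hdeg hetale r hrinj hroots hrmult h0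
    ((hmult 0 1 h0).1 hram) hone
  exact ⟨h2, z, hz, hmom, hiso⟩

end Reduction

/-! ### Rigidity of the adapted coordinates under inertia. -/

section Rigidity

open Finset

theorem RegularAtInfinity.not_dvd_sum {n : ℕ} {a : Fin n → ℕ} {p : ℕ} (h : RegularAtInfinity a p)
    (S : Finset (Fin n)) (hS : S.Nonempty) (hS' : S ≠ univ) : ¬ p ∣ ∑ i ∈ S, a i := fun hd =>
  h.2 (hd.trans (dvd_prod_of_mem (fun S : Finset (Fin n) => ∑ j ∈ S, a j)
    (mem_filter.2 ⟨mem_univ S, hS, hS'⟩)))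

variable {M Γ₀ ι : Type*} [Field M] [LinearOrderedCommGroupWithZero Γ₀] {w : Valuation M Γ₀}
  [Fintype ι]

/-- Since `μ` is a unit and `e` is prime to `p`, `σ` fixes `μ`, hence `τ ^ l * μ`. Then `σ ∘ v`
solves the same system as `v`, with the same residues and the same zero coordinate, so the two
agree. -/
theorem map_eq_of_moments {p : ℕ} (hp : ∀ q : ℕ, w q < 1 ↔ p ∣ q)
    (hnat : ∀ q : ℕ, w q ≤ 1) (a : ι → ℕ)
    (hreg : ∀ S : Finset ι, S.Nonempty → S ≠ univ → ¬ p ∣ ∑ i ∈ S, a i)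
    {e : ℕ} (he : 0 < e) (hep : e < p) (hcard : Fintype.card ι = e + 1) {τ μ : M} {l m N : ℕ}
    (hμ : μ ^ e = m) (hm : ¬ p ∣ m) (hπ : (τ ^ l * μ) ^ e = N) (hN : p ∣ N)
    (hπ0 : τ ^ l * μ ≠ 0) (v : ι → M) {i₀ : ι} (h0 : v i₀ = 0)
    (hmom : ∀ k ≤ e, ∑ i, (a i : M) * v i ^ k = (τ ^ l * μ) ^ e / (τ ^ l * μ) ^ k)
    (σ : M →+* M) (hσ : ∀ x, w x ≤ 1 → w (σ x - x) < 1) (hστ : σ τ = τ) :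
    σ μ = μ ∧ ∀ i, σ (v i) = v i := by
  have hunit : ∀ q : ℕ, ¬ p ∣ q → w (q : M) = 1 := fun q hq =>
    le_antisymm (hnat q) (not_lt.1 fun h => hq ((hp q).1 h))
  have hwπ : w (τ ^ l * μ) < 1 := by
    rw [← pow_lt_one_iff_of_nonneg zero_le he.ne', ← map_pow, hπ, hp]
    exact hN
  have hwμ : w μ = 1 := by
    rw [← pow_eq_one_iff_of_nonneg zero_le he.ne', ← map_pow, hμ, hunit m hm]
  have hk : ∀ k, 0 < k → k ≤ e → w (k : M) = 1 := fun k hk hke =>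
    hunit k fun h => absurd (Nat.le_of_dvd hk h) (by omega)
  have hσμ : σ μ = μ := by
    refine eq_of_pow_eq hnat hwμ (hσ μ hwμ.le) (hk e he le_rfl) ?_
    rw [← map_pow, hμ, map_natCast]
  refine ⟨hσμ, fun i => ?_⟩
  have hle := valuation_le_one_of_moments hp hnat a hreg hwπ hπ0 v h0 he hcard hmom
  have ha : ∀ i, w (a i : M) = 1 := fun i => hunit _ fun h => by
    refine hreg {i} (singleton_nonempty i) (fun h' => ?_) (by simpa using h)
    have := congrArg card h'
    rw [card_singleton, card_univ, hcard] at this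
    omega
  have := eq_of_moments_eq (v := v) (v' := fun i => σ (v i)) (i₀ := i₀) hnat a ha hcard hk hle
    (fun i j hij => valuation_sub_eq_one_of_moments hp hnat a hreg hwπ hπ0 v h0 he hcard hmom hij)
    (by rw [h0, map_zero]) (fun i => hσ _ (hle i)) (fun k hk => ?_)
  · exact congrFun this i
  · have h1 := congrArg σ (hmom k hk)
    simp only [map_sum, map_mul, map_pow, map_natCast, map_div₀, hστ, hσμ] at h1
    rw [h1, hmom k hk]

end Rigidity

/-! ### Field of moduli of a tree in normal form; adapted coordinates. -/

section Moduli

open Polynomial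

theorem iso_weightedProd_smul {K : Type*} [Field K] {n : ℕ} (a : Fin n → ℕ) (z : Fin n → K) {c : K}
    (hc : c ≠ 0) : Iso (algebraMap K[X] (RatFunc K) (weightedProd a z))
      (algebraMap K[X] (RatFunc K) (weightedProd a fun i => c * z i)) := by
  have hdet : c * 1 - 0 * 0 ≠ 0 := by simpa using hc
  obtain ⟨f, hf⟩ := exists_comp_hom hdet
  refine ⟨c, 0, 0, 1, hdet, ?_⟩
  have hX : f RatFunc.X = RatFunc.C c * RatFunc.X := by rw [hf]; simp [comp, moebius]
  have hC : ∀ y, f (RatFunc.C y) = RatFunc.C y := f.commutes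
  rw [← hf]
  simp only [weightedProd, map_prod, map_pow, map_sub, map_one, map_mul, RatFunc.algebraMap_C,
    RatFunc.algebraMap_X, hX, hC]
  refine Finset.prod_congr rfl fun i _ => ?_
  ring

variable {F K : Type*} [Field F] [Field K] [Algebra F K] {n : ℕ} {a : Fin n → ℕ} {z : Fin n → K}
  {T : CoverClass K} (hT : T = Quotient.mk (isoSetoid K) (algebraMap _ _ (weightedProd a z)))

include hT in
theorem mem_stabilizer_of_weightedProd {σ : Gal(K/F)} (hσ : ∀ i, σ (z i) = z i) :
    σ ∈ MulAction.stabilizer Gal(K/F) T := by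
  rw [MulAction.mem_stabilizer_iff, hT]
  refine congrArg (Quotient.mk (isoSetoid K)) ?_
  rw [conj_algebraMap]
  congr 1
  simp [weightedProd, Polynomial.map_prod, hσ]

include hT in
theorem fieldOfModuli_le_of_weightedProd [IsGalois F K] (L : IntermediateField F K)
    (hL : ∀ i, z i ∈ L) : fieldOfModuli F T ≤ L := by
  rw [← InfiniteGalois.fixedField_fixingSubgroup L]
  refine IntermediateField.fixedField_antitone fun σ hσ => ?_
  exact mem_stabilizer_of_weightedProd hT fun i =>
    (IntermediateField.mem_fixingSubgroup_iff L σ).1 hσ _ (hL i)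

/-- The coordinates of a diameter four tree adapted to its reduction at a prime which is regular at
infinity. -/
theorem exists_adapted_moments {K : Type*} [Field K] [CharZero K] {e : ℕ} (a : Fin (e + 1) → ℕ)
    {z : Fin (e + 1) → K} (hz : ∀ i, z i ≠ 0)
    (hmom : ∀ k, 0 < k → k ≤ e → ∑ i, (a i : K) * z i ^ k = 0) {π : K} (hπ : π ≠ 0)
    (hsum : π ^ e = (∑ i, a i : ℕ)) : ∃ v : Fin (e + 1) → K, v 0 = 0 ∧
      (∀ k ≤ e, ∑ i, (a i : K) * v i ^ k = π ^ e / π ^ k) ∧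
      ∃ c, c ≠ 0 ∧ ∀ i, c * z i = π * v i - 1 := by
  have hc : -(z 0)⁻¹ ≠ 0 := neg_ne_zero.2 (inv_ne_zero (hz 0))
  -- The scaling `c z₀ = -1` makes the coordinate `v 0` vanish.
  obtain ⟨c, hc0, hcz⟩ : ∃ c : K, c ≠ 0 ∧ c * z 0 = -1 := ⟨_, hc, by simp [hz 0]⟩
  refine ⟨fun i => (c * z i + 1) / π, by simp [hcz], fun k hk => ?_, c, hc0, fun i => by field_simp; ring⟩
  -- In the binomial expansion every positive power of `z` sums to zero; only the constant term `∑
  -- aᵢ` survives.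
  have h1 : ∑ i, (a i : K) * (c * z i + 1) ^ k = π ^ e := by
    simp_rw [add_pow, Finset.mul_sum]
    rw [Finset.sum_comm, Finset.sum_range_succ', Finset.sum_eq_zero, hsum]
    · simp
    · intro j hj
      have := hmom (j + 1) j.succ_pos (by have := Finset.mem_range.1 hj; omega)
      rw [← mul_zero (c ^ (j + 1) * (k.choose (j + 1) : K)), ← this, Finset.mul_sum]
      refine Finset.sum_congr rfl fun i _ => ?_
      rw [one_pow, mul_pow]
      ring
  rw [← h1, Finset.sum_div]
  exact Finset.sum_congr rfl fun i _ => by rw [div_pow, mul_div_assoc]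

end Moduli

/-! ### The bound for trees in adapted coordinates. -/

section Main

local notation "Qbar" => AlgebraicClosure ℚ

instance : IsAlgClosure ℚ Qbar := by
  convert AlgebraicClosure.instIsAlgClosure ℚ
  · rfl
  · exact Subsingleton.elim _ _

theorem valuation_natCast_lt_one_iff {M : Type*} [Field M] [NumberField M] {p : ℕ}
    (w : IsDedekindDomain.HeightOneSpectrum (𝓞 M))
    (hw : w.asIdeal.under ℤ = Ideal.span {(p : ℤ)}) (q : ℕ) : w.valuation M (q : M) < 1 ↔ p ∣ q := by
  have h1 : (q : M) = algebraMap (𝓞 M) M (q : 𝓞 M) := by simp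
  have h2 : (q : 𝓞 M) = algebraMap ℤ (𝓞 M) (q : ℤ) := by simp
  rw [h1, w.valuation_lt_one_iff_mem, h2, ← Ideal.mem_comap, ← Ideal.under_def, hw,
    Ideal.mem_span_singleton, Int.natCast_dvd_natCast]

theorem ramificationIdx_le_of_moments {e p : ℕ} (hp : p.Prime) (he : 0 < e) (hep : e < p)
    (a : Fin (e + 1) → ℕ) (hreg : RegularAtInfinity a p) {T : CoverClass Qbar} {E l m : ℕ}
    (hE : 0 < E) (hm : ¬ p ∣ m) {τ μ : Qbar} (hτ : τ ^ E = p) (hμ : μ ^ e = m)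
    (hπ : (τ ^ l * μ) ^ e = (∑ i, a i : ℕ)) (hπ0 : τ ^ l * μ ≠ 0) {v : Fin (e + 1) → Qbar}
    (hv0 : v 0 = 0)
    (hv : ∀ k ≤ e, ∑ i, (a i : Qbar) * v i ^ k = (τ ^ l * μ) ^ e / (τ ^ l * μ) ^ k)
    (hT : T = Quotient.mk (isoSetoid Qbar)
      (algebraMap _ _ (weightedProd a fun i => τ ^ l * μ * v i - 1))) :
    NumberField (fieldOfModuli ℚ T) ∧
      ∀ 𝔭 : Ideal (𝓞 (fieldOfModuli ℚ T)), 𝔭.IsMaximal →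
        𝔭.LiesOver (Ideal.span {(p : ℤ)}) → 𝔭.ramificationIdx ℤ ≤ E := by
  -- A finite Galois extension of `ℚ` containing the coordinates and `τ`, `μ`; it therefore contains
  -- the field of moduli.
  let M := FiniteGaloisIntermediateField.adjoin ℚ ({τ, μ} ∪ Set.range v)
  have hsub : ({τ, μ} ∪ Set.range v : Set Qbar) ⊆ M.toIntermediateField :=
    FiniteGaloisIntermediateField.subset_adjoin ℚ _
  have hτM : τ ∈ M.toIntermediateField := hsub (by simp)
  have hμM : μ ∈ M.toIntermediateField := hsub (by simp)
  have hvM : ∀ i, v i ∈ M.toIntermediateField := fun i => hsub (by simp)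
  have hle : fieldOfModuli ℚ T ≤ M.toIntermediateField :=
    fieldOfModuli_le_of_weightedProd hT _ fun i => sub_mem (mul_mem (mul_mem (pow_mem hτM l) hμM)
      (hvM i)) (one_mem _)
  have hfd : FiniteDimensional ℚ (fieldOfModuli ℚ T) :=
    FiniteDimensional.of_injective (IntermediateField.inclusion hle).toLinearMap
      (IntermediateField.inclusion_injective hle)
  have hnf : NumberField (fieldOfModuli ℚ T) := { to_finiteDimensional := hfd }
  refine ⟨hnf, fun 𝔭 h𝔭 h𝔭p => ?_⟩
  have : NumberField M := { to_finiteDimensional := inferInstance }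
  have : IsGalois ℚ M := by
    convert M.isGalois
    exact Subsingleton.elim _ _
  let : Algebra (fieldOfModuli ℚ T) M := (IntermediateField.inclusion hle).toAlgebra
  obtain ⟨P, hP, hP𝔭⟩ := Ideal.exists_maximal_ideal_liesOver_of_isIntegral 𝔭 (S := 𝓞 M)
  have hPp : P.LiesOver (Ideal.span {(p : ℤ)}) := Ideal.LiesOver.trans P 𝔭 _
  have hPbot : P ≠ ⊥ := by
    rintro rfl
    have hmem : (p : ℤ) ∈ Ideal.under ℤ (⊥ : Ideal (𝓞 M)) :=
      hPp.over ▸ Ideal.mem_span_singleton_self _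
    rw [Ideal.under_def, Ideal.mem_comap, Ideal.mem_bot] at hmem
    exact hp.ne_zero (by simpa using hmem)
  let w : IsDedekindDomain.HeightOneSpectrum (𝓞 M) := ⟨P, hP.isPrime, hPbot⟩
  have hinj : Function.Injective (algebraMap M Qbar) := (algebraMap M Qbar).injective
  refine ramificationIdx_le 𝔭 P hE (⟨τ, hτM⟩ : M) p ?_ fun σ hσ hστ x => ?_
  · apply hinj
    simpa using hτ
  have hnat : ∀ q : ℕ, w.valuation M (q : M) ≤ 1 := fun q => by
    simpa using w.valuation_le_one (K := M) (q : 𝓞 M)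
  let τ' : M := ⟨τ, hτM⟩
  let μ' : M := ⟨μ, hμM⟩
  let v' : Fin (e + 1) → M := fun i => ⟨v i, hvM i⟩
  have hτ' : algebraMap M Qbar τ' = τ := rfl
  have hμ' : algebraMap M Qbar μ' = μ := rfl
  have hv' : ∀ i, algebraMap M Qbar (v' i) = v i := fun _ => rfl
  have hμe : μ' ^ e = m := hinj (by rw [map_pow, hμ', hμ, map_natCast])
  have hπe : (τ' ^ l * μ') ^ e = (∑ i, a i : ℕ) :=
    hinj (by rw [map_pow, map_mul, map_pow, hμ', hτ', hπ, map_natCast])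
  have hπ0' : τ' ^ l * μ' ≠ 0 := fun h => hπ0 (by
    rw [← hτ', ← hμ', ← map_pow, ← map_mul, h, map_zero])
  have hv0' : v' 0 = 0 := hinj (by rw [hv', hv0, map_zero])
  have hmom : ∀ k ≤ e, ∑ i, (a i : M) * v' i ^ k = (τ' ^ l * μ') ^ e / (τ' ^ l * μ') ^ k :=
    fun k hk => hinj (by
      simp only [map_sum, map_mul, map_pow, map_div₀, map_natCast, hv', hτ', hμ', hv k hk])
  obtain ⟨hσμ, hσv⟩ := map_eq_of_moments (valuation_natCast_lt_one_iff w hPp.over.symm) hnat a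
    hreg.not_dvd_sum he hep (by simp) hμe hm hπe hreg.1 hπ0' v' hv0' hmom (σ : M →+* M)
    (fun x hx => valuation_sub_lt_one w hσ hx) hστ
  -- The field of moduli is defined by automorphisms of the algebraic closure, so `σ` is extended
  -- there; the extension fixes all coordinates and thus stabilizes `T`.
  let σ' : Gal(Qbar/ℚ) := σ.liftNormal Qbar
  have hσ' : ∀ y : M, σ' (y : Qbar) = σ y := fun y => σ.liftNormal_commutes Qbar y
  have hstab : σ' ∈ MulAction.stabilizer Gal(Qbar/ℚ) T := by
    refine mem_stabilizer_of_weightedProd hT fun i => ?_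
    have h1 := hσ' ⟨τ, hτM⟩
    have h2 := hσ' ⟨μ, hμM⟩
    have h3 := hσ' ⟨v i, hvM i⟩
    rw [hστ] at h1
    rw [show σ ⟨μ, hμM⟩ = _ from hσμ] at h2
    rw [show σ ⟨v i, hvM i⟩ = _ from hσv i] at h3
    rw [map_sub, map_mul, map_mul, map_pow, map_one]
    exact congrArg₂ _ (congrArg₂ _ (congrArg₂ _ (congrArg (· ^ l) h1) h2) h3) rfl
  have hx : σ' (x : Qbar) = x := x.2 ⟨σ', hstab⟩
  exact hinj ((hσ' (algebraMap _ M x)).symm.trans hx)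

end Main

end DiamFour

end

/-! ### The corollary. -/

open DiamFour in
theorem corollary9p6 {n : ℕ} (a : Fin n → ℕ) (ha : ∀ i, 0 < a i)
    (T : CoverClass (AlgebraicClosure ℚ)) (hT : T ∈ valencyClass a (AlgebraicClosure ℚ))
    (p h m : ℕ) (hp : p.Prime) (hpn : n < p) (hreg : RegularAtInfinity a p)
    (hsum : ∑ i, a i = p ^ h * m) (hm : p.Coprime m) :
    NumberField (fieldOfModuli ℚ T) ∧
      ∀ 𝔭 : Ideal (𝓞 (fieldOfModuli ℚ T)), 𝔭.IsMaximal →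
        𝔭.LiesOver (Ideal.span {(p : ℤ)}) →
          𝔭.ramificationIdx ℤ ≤ (n - 1) / (n - 1).gcd h := by
  obtain ⟨β, hβ, rfl⟩ := hT
  obtain ⟨hn, z, hz, hmom, hiso⟩ := hβ.exists_weightedProd ha
  obtain ⟨e, rfl⟩ : ∃ e, n = e + 1 := ⟨n - 1, by omega⟩
  rw [Nat.add_sub_cancel]
  have he : 0 < e := by omega
  have hm' : ¬ p ∣ m := (hp.coprime_iff_not_dvd).1 hm
  have hg : 0 < e.gcd h := Nat.gcd_pos_of_pos_left h he
  obtain ⟨E, hE⟩ := Nat.gcd_dvd_left e h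
  obtain ⟨l, hl⟩ := Nat.gcd_dvd_right e h
  have hdiv : e / e.gcd h = E := Nat.div_eq_of_eq_mul_right hg hE
  rw [hdiv]
  have hE0 : 0 < E := Nat.pos_of_mul_pos_left (hE ▸ he)
  -- Since `l * e = E * h`, the power `τ ^ l` is an `e`-th root of `p ^ h`; using `τ` with `τ ^ E =
  -- p` instead of an `e`-th root of `p` gains the factor `gcd(e, h)`.
  obtain ⟨τ, hτ⟩ := IsAlgClosed.exists_pow_nat_eq (p : AlgebraicClosure ℚ) hE0
  obtain ⟨μ, hμ⟩ := IsAlgClosed.exists_pow_nat_eq (m : AlgebraicClosure ℚ) he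
  have hπ : (τ ^ l * μ) ^ e = (∑ i, a i : ℕ) := by
    have hle : l * e = E * h := by
      conv_lhs => rw [hE]
      conv_rhs => rw [hl]
      ring
    rw [mul_pow, ← pow_mul, hle, pow_mul, hτ, hμ, hsum]
    push_cast
    rfl
  have hτ0 : τ ≠ 0 := by
    rintro rfl
    rw [zero_pow hE0.ne'] at hτ
    exact hp.ne_zero (by exact_mod_cast hτ.symm)
  have hμ0 : μ ≠ 0 := by
    rintro rfl
    rw [zero_pow he.ne'] at hμ
    have : m = 0 := by exact_mod_cast hμ.symm
    exact hm' (this ▸ dvd_zero p)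
  have hπ0 : τ ^ l * μ ≠ 0 := mul_ne_zero (pow_ne_zero _ hτ0) hμ0
  obtain ⟨v, hv0, hv, c, hc, hcz⟩ := exists_adapted_moments a hz
    (fun k hk hk' => hmom k hk (by omega)) hπ0 hπ
  refine ramificationIdx_le_of_moments hp he (by omega) a hreg hE0 hm' hτ hμ hπ hπ0 hv0 hv ?_
  refine Quotient.sound ?_
  rw [← funext hcz]
  exact hiso.trans (iso_weightedProd_smul a z hc)
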